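/- **Theorem 2.** Let $n\ge 1$ be an integer, let $p,q>1$, $R>0$, and let $b\in L^1([0,\infty))$ be nonnegative. Write $B_\rho=\{x\in\mathbb{R}^n:|x|\le\rho\}$. For $\varepsilon>0$ consider the Cauchy problem $$ \begin{cases} \partial_t^2u-\Delta u+\partial_tu=|v|^p, & t>0,\ x\in\mathbb{R}^n,\\ \partial_t^2v-\Delta v+b(t)\,\partial_tv=|u|^q, & t>0,\ x\in\mathbb{R}^n,\\ (u,\partial_tu,v,\partial_tv)(0,x)=\varepsilon\,(u_0,u_1,v_0,v_1)(x), & x\in\mathbb{R}^n, \end{cases} $$ where $u_0,v_0\in W^{1,1}_{\mathrm{loc}}(\mathbb{R}^n)$ and $u_1,v_1\in L^1_{\mathrm{loc}}(\mathbb{R}^n)$ are each nonnegative, not almost everywhere zero, and supported in $B_R$. For $0<T\le\infty$, a *weak solution on $[0,T)$* is a pair $(u,v)$ with $$u,v\in \mathcal{C}\big([0,T),W^{1,1}_{\mathrm{loc}}(\mathbb{R}^n)\big)\cap \mathcal{C}^1\big([0,T),L^1_{\mathrm{loc}}(\mathbb{R}^n)\big),\quad u\in L^q_{\mathrm{loc}}([0,T)\times\mathbb{R}^n),\quad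 v\in L^p_{\mathrm{loc}}([0,T)\times\mathbb{R}^n),$$ such that $\operatorname{supp}u(t,\cdot)\subset B_{R+t}$ and $\operatorname{supp}v(t,\cdot)\subset B_{R+t}$ for all $t\in(0,T)$, $u(0,\cdot)=\varepsilon u_0$, $v(0,\cdot)=\varepsilon v_0$, and, for all $\phi,\psi\in \mathcal{C}_0^\infty([0,T)\times\mathbb{R}^n)$ and all $t\in(0,T)$, $$\int_0^t\!\!\int_{\mathbb{R}^n}\big(-\partial_su\,\partial_s\phi+\nabla u\cdot\nabla\phi+\partial_su\,\phi\big)\,dx\,ds+\int_{\mathbb{R}^n}\partial_tu(t,x)\phi(t,x)\,dx=\varepsilon\int_{\mathbb{R}^n}u_1(x)\phi(0,x)\,dx+\int_0^t\!\!\int_{\mathbb{R}^n}|v|^p\phi\,dx\,ds,$$ $$\int_0^t\!\!\int_{\mathbb{R}^n}\big(-\partial_sv\,\partial_s\psi+\nabla v\cdot\nabla\psi+b(s)\,\partial_sv\,\psi\big)\,dx\,ds+\int_{\mathbb{R}^n}\partial_tv(t,x)\psi(t,x)\,dx=\varepsilon\int_{\mathbb{R}^n}v_1(x)\psi(0,x)\,dx+\int_0^t\!\!\int_{\mathbb{R}^n}|u|^q\psi\,dx\,ds.$$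 Suppose that $$\Gamma(n,p,q,0)=\max\left\{\frac{2+p^{-1}}{pq-1}-\frac{n-1}{2},\ \frac{q+2}{pq-1}-n+1,\ \frac{2p+1}{pq-1}-n\right\}>0 .$$ Then there exist $\varepsilon_0>0$ and $C>0$, depending only on $n,b,p,q,R,u_0,u_1,v_0,v_1$, such that for every $\varepsilon\in(0,\varepsilon_0]$ weak solutions blow up in finite time, with upper lifespan bound of order $\varepsilon^{-1/\Gamma(n,p,q,0)}$: if a weak solution exists on $[0,T)$ with $0<T\le\infty$, then $T<\infty$ and $$T\le C\,\varepsilon^{-\frac{1}{\Gamma(n,p,q,0)}}.$$ -/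

import Mathlib

open MeasureTheory Set Filter Topology
open scoped ContDiff

noncomputable section

namespace Nakao

/-- The Euclidean space `ℝⁿ`. -/
abbrev Space (n : ℕ) : Type := EuclideanSpace ℝ (Fin n)

/-- The exponent
`Γ(n,p,q,μ) = max {(2 + p⁻¹)/(pq-1) - (n+μ-1)/2, (q+2)/(pq-1) - n + [1-μ]₊, (2p+1)/(pq-1) - n}`. -/
def Gam (n : ℕ) (p q μ : ℝ) : ℝ :=
  max (max ((2 + p⁻¹) / (p * q - 1) - ((n : ℝ) + μ - 1) / 2)
      ((q + 2) / (p * q - 1) - (n : ℝ) + max (1 - μ) 0))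
    ((2 * p + 1) / (p * q - 1) - (n : ℝ))

/-- The value of `Γ` at `μ = 0`. -/
theorem Gam_zero (n : ℕ) (p q : ℝ) :
    Gam n p q 0 =
      max (max ((2 + p⁻¹) / (p * q - 1) - ((n : ℝ) - 1) / 2)
          ((q + 2) / (p * q - 1) - (n : ℝ) + 1))
        ((2 * p + 1) / (p * q - 1) - (n : ℝ)) := by
  simp [Gam]

/-- `g` is the weak gradient of `f` on `ℝⁿ`, both being locally integrable; thus
`f ∈ W^{1,1}_loc(ℝⁿ)` means that `f` has a weak gradient. -/
def HasWeakGradient {n : ℕ} (f : Space n → ℝ) (g : Space n → Space n) : Prop :=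
  LocallyIntegrable f ∧ LocallyIntegrable g ∧
    ∀ φ : Space n → ℝ, ContDiff ℝ ∞ φ → HasCompactSupport φ →
      ∫ x, f x • gradient φ x = -∫ x, φ x • g x

/-- The space `W^{1,1}_loc(ℝⁿ)`. -/
def MemW11loc {n : ℕ} (f : Space n → ℝ) : Prop :=
  ∃ g : Space n → Space n, HasWeakGradient f g

/-- The set of times `[0,T)`, for an extended real `T` (so that `T = ∞` is allowed). -/
def times (T : EReal) : Set ℝ := {t : ℝ | 0 ≤ t ∧ (t : EReal) < T}

/-- `f ∈ C([0,T), L¹_loc(ℝⁿ; F))`. -/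
def ContL1loc {n : ℕ} {F : Type} [NormedAddCommGroup F] (T : EReal)
    (f : ℝ → Space n → F) : Prop :=
  (∀ t ∈ times T, LocallyIntegrable (f t)) ∧
    ∀ t₀ ∈ times T, ∀ K : Set (Space n), IsCompact K →
      Tendsto (fun t => ∫ x in K, ‖f t x - f t₀ x‖) (𝓝[times T] t₀) (𝓝 0)

/-- `f ∈ C¹([0,T), L¹_loc(ℝⁿ))` with time derivative `f'` (one-sided at time `0`). -/
def HasTimeDeriv {n : ℕ} (T : EReal) (f f' : ℝ → Space n → ℝ) : Prop :=
  ContL1loc T f ∧ ContL1loc T f' ∧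
    ∀ t₀ ∈ times T, ∀ K : Set (Space n), IsCompact K →
      Tendsto (fun t => ∫ x in K, ‖(f t x - f t₀ x) / (t - t₀) - f' t₀ x‖)
        (𝓝[times T \ {t₀}] t₀) (𝓝 0)

/-- `f ∈ C([0,T), W^{1,1}_loc(ℝⁿ))` with weak spatial gradient `g`. -/
def HasSpaceGradient {n : ℕ} (T : EReal) (f : ℝ → Space n → ℝ)
    (g : ℝ → Space n → Space n) : Prop :=
  (∀ t ∈ times T, HasWeakGradient (f t) (g t)) ∧ ContL1loc T f ∧ ContL1loc T g

/-- `f ∈ L^r_loc([0,T) × ℝⁿ)`. -/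
def MemLrloc {n : ℕ} (T : EReal) (r : ℝ) (f : ℝ → Space n → ℝ) : Prop :=
  ∀ K : Set (ℝ × Space n), IsCompact K → K ⊆ times T ×ˢ univ →
    MemLp (fun z : ℝ × Space n => f z.1 z.2) (ENNReal.ofReal r) (volume.restrict K)

/-- Test functions in `C₀^∞([0,T) × ℝⁿ)`, as restrictions to nonnegative times of smooth
compactly supported functions on `(-∞,T) × ℝⁿ`. -/
def IsTest {n : ℕ} (T : EReal) (φ : ℝ → Space n → ℝ) : Prop :=
  ContDiff ℝ ∞ (fun z : ℝ × Space n => φ z.1 z.2) ∧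
    HasCompactSupport (fun z : ℝ × Space n => φ z.1 z.2) ∧
    ∀ z ∈ tsupport (fun z : ℝ × Space n => φ z.1 z.2), (z.1 : EReal) < T

/-- The (essential) support of `f` is contained in the closed ball `B_ρ` of radius `ρ`
around the origin. -/
def SuppInBall {n : ℕ} (ρ : ℝ) (f : Space n → ℝ) : Prop :=
  ∀ᵐ x : Space n, ρ < ‖x‖ → f x = 0

/-- The weak formulation, on `[0,T)`, of `∂ₜ²w - Δw + β(t) ∂ₜw = h` with initial velocity `w₁`,
where `w'` and `Dw` are the time derivative and the spatial gradient of `w`. -/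
def WeakIdentity {n : ℕ} (T : EReal) (β : ℝ → ℝ) (w' : ℝ → Space n → ℝ)
    (Dw : ℝ → Space n → Space n) (w₁ : Space n → ℝ) (h : ℝ → Space n → ℝ) : Prop :=
  ∀ φ : ℝ → Space n → ℝ, IsTest T φ → ∀ t : ℝ, 0 < t → (t : EReal) < T →
    (∫ s in (0 : ℝ)..t, ∫ x,
        (-(w' s x * deriv (fun r => φ r x) s) + inner ℝ (Dw s x) (gradient (φ s) x)
          + β s * w' s x * φ s x))
      + ∫ x, w' t x * φ t x
    = (∫ x, w₁ x * φ 0 x) + ∫ s in (0 : ℝ)..t, ∫ x, h s x * φ s x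

/-- `(u,v)` is a weak solution on `[0,T)` of
`∂ₜ²u - Δu + ∂ₜu = |v|^p`, `∂ₜ²v - Δv + b(t)∂ₜv = |u|^q`,
`(u,∂ₜu,v,∂ₜv)(0,·) = ε(u₀,u₁,v₀,v₁)`, with support in the cone `|x| ≤ R + t`. -/
def IsWeakSolution {n : ℕ} (p q : ℝ) (b : ℝ → ℝ) (R ε : ℝ) (u₀ u₁ v₀ v₁ : Space n → ℝ)
    (T : EReal) (u v : ℝ → Space n → ℝ) : Prop :=
  0 < T ∧
  ∃ (u' v' : ℝ → Space n → ℝ) (Du Dv : ℝ → Space n → Space n),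
    HasSpaceGradient T u Du ∧ HasTimeDeriv T u u' ∧ MemLrloc T q u ∧
    HasSpaceGradient T v Dv ∧ HasTimeDeriv T v v' ∧ MemLrloc T p v ∧
    (∀ t : ℝ, 0 < t → (t : EReal) < T → SuppInBall (R + t) (u t) ∧ SuppInBall (R + t) (v t)) ∧
    u 0 =ᵐ[volume] (fun x => ε * u₀ x) ∧ v 0 =ᵐ[volume] (fun x => ε * v₀ x) ∧
    WeakIdentity T (fun _ => 1) u' Du (fun x => ε * u₁ x) (fun s x => |v s x| ^ p) ∧
    WeakIdentity T b v' Dv (fun x => ε * v₁ x) (fun s x => |u s x| ^ q)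

/-- A nonnegative, nontrivial initial datum with support in `B_R`
(all understood almost everywhere). -/
def IsDatum {n : ℕ} (R : ℝ) (f : Space n → ℝ) : Prop :=
  (∀ᵐ x : Space n, 0 ≤ f x) ∧ ¬ (f =ᵐ[volume] (fun _ => (0 : ℝ))) ∧ SuppInBall R f

end Nakao

end

/-! Pairing each equation with `exp (x·ξ)` in space gives a scalar equation H'' + βH' = |ξ|²H + N,
where H is the moment of the unknown and N that of the nonlinearity (`IsMoment`). The supports lie
in a cone, so after a cut-off these exponentials are admissible (`isMoment_of_weakIdentity`).

At ξ = 0 one tests in time with θ = (1 - t/S)^(j+2). Let A = ∫∫θ|u|^q and B = ∫∫θ|v|^p. In the u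
equation the damping dominates and one derivative falls on θ, a gain of S⁻¹ (`heat_estimate`). In
the v equation the integrable damping costs only the factor exp(-∫b), so the full wave gain S⁻²
survives (`wave_estimate`). Hölder on the truncated cone, of volume about S^(n+1), closes the loop
(`integral_abs_mean_le`): A + cε ≤ K S^(-2+(n+1)(1-1/p)) B^(1/p) and B + cε ≤ K S^(-1+(n+1)(1-1/q))
A^(1/q).

For 1 ≤ |ξ| ≤ 2 the moments of v grow at least like ε exp(|ξ|t) (`IsMoment.growth`). Averaging over
these frequencies produces a weight concentrated at the light cone with the decay (1+|x|)^(-(n-1)/2)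
of free waves. Hölder against this weight bounds ∫|v|^p below by a multiple of ε^p
(1+t)^((n-1)(1-p/2)) (`integral_rpow_ge_of_moments`), hence B below by a multiple of ε^p
S^(1+(n-1)(1-p/2)).

In logarithms everything is linear (`exponent_algebra`). The loop bounds A and B above by powers of
S; comparison with the wave lower bound for B, with the data term beside A and with the data term
beside B gives the three entries of Γ. As Γ > 0, this bounds every S below the lifespan. -/

namespace Nakao

/-! ### Scalar first-order equations with integrable damping -/

theorem absolutelyContinuousOnInterval_exp {f : ℝ → ℝ} {a b : ℝ}
    (hf : AbsolutelyContinuousOnInterval f a b) :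
    AbsolutelyContinuousOnInterval (fun t => Real.exp (f t)) a b := by
  obtain ⟨M, hM⟩ := hf.exists_bound
  have h1 : ContDiffOn ℝ 1 Real.exp (Icc (-M) M) := Real.contDiff_exp.contDiffOn
  obtain ⟨K, hK⟩ := h1.exists_lipschitzOnWith (by decide) (convex_Icc _ _) isCompact_Icc
  rw [absolutelyContinuousOnInterval_iff] at hf ⊢
  intro ε hε
  obtain ⟨δ, hδ, h⟩ := hf (ε / (K + 1)) (by positivity)
  refine ⟨δ, hδ, fun E hE hEδ => ?_⟩
  have h2 := h E hE hEδ
  have hmem : ∀ x ∈ uIcc a b, f x ∈ Icc (-M) M := fun x hx => by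
    have := hM x hx
    rw [Real.norm_eq_abs] at this
    exact abs_le.mp this
  calc _ ≤ ∑ i ∈ Finset.range E.1, (K : ℝ) * dist (f (E.2 i).1) (f (E.2 i).2) :=
        Finset.sum_le_sum fun i hi =>
          hK.dist_le_mul _ (hmem _ (hE.1 i hi).1) _ (hmem _ (hE.1 i hi).2)
    _ = K * ∑ i ∈ Finset.range E.1, dist (f (E.2 i).1) (f (E.2 i).2) := by
        rw [Finset.mul_sum]
    _ ≤ K * (ε / (K + 1)) := by gcongr
    _ < (K + 1) * (ε / (K + 1)) := by gcongr; linarith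
    _ = ε := by field

/-- Lower bound for solutions of `y' + b y = f'` with `f` monotone, in integrated form. -/
theorem damped_lower_bound {b y f : ℝ → ℝ} {t : ℝ} (ht : 0 ≤ t)
    (hb : IntervalIntegrable b volume 0 t) (hb0 : ∀ᵐ s : ℝ, s ∈ Icc 0 t → 0 ≤ b s)
    (hy : ContinuousOn y (Icc 0 t))
    (hf : ∀ s ∈ Icc 0 t, y s + ∫ r in (0 : ℝ)..s, b r * y r = f s)
    (hmono : ∀ s ∈ Icc 0 t, f s ≤ f t) :
    f t * Real.exp (-∫ r in (0 : ℝ)..t, b r) ≤ y t := by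
  have hu : uIcc 0 t = Icc 0 t := uIcc_of_le ht
  have hby : IntervalIntegrable (fun r => b r * y r) volume 0 t :=
    hb.mul_continuousOn (hu ▸ hy)
  set β : ℝ → ℝ := fun s => ∫ r in (0 : ℝ)..s, b r with hβ
  set Y : ℝ → ℝ := fun s => ∫ r in (0 : ℝ)..s, b r * y r with hY
  have acβ : AbsolutelyContinuousOnInterval β 0 t :=
    hb.absolutelyContinuousOnInterval_intervalIntegral (by simp)
  have acE := absolutelyContinuousOnInterval_exp acβ
  have acY : AbsolutelyContinuousOnInterval Y 0 t :=
    hby.absolutelyContinuousOnInterval_intervalIntegral (by simp)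
  have acP := acE.fun_mul acY
  have h1 := acP.integral_deriv_eq_sub
  have h2 := acE.integral_deriv_eq_sub
  have hY0 : Y 0 = 0 := by simp [hY]
  have hβ0 : β 0 = 0 := by simp [hβ]
  -- Integrating factor: with Y = ∫by, (e^β Y)' = e^β b (Y + y) = (e^β)' f ≤ f(t) (e^β)'. As b is
  -- merely integrable, this holds almost everywhere, and absolute continuity permits integrating
  -- it.
  have hle : ∫ x in (0 : ℝ)..t, deriv (fun s => Real.exp (β s) * Y s) x ≤
      ∫ x in (0 : ℝ)..t, f t * deriv (fun s => Real.exp (β s)) x := by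
    refine intervalIntegral.integral_mono_ae_restrict ht acP.intervalIntegrable_deriv
      (acE.intervalIntegrable_deriv.const_mul _) ?_
    rw [EventuallyLE, ae_restrict_iff' measurableSet_Icc]
    filter_upwards [hb.ae_hasDerivAt_integral, hby.ae_hasDerivAt_integral, hb0] with s d1 d2 hs0 hs
    have hs' : s ∈ uIcc 0 t := hu ▸ hs
    have e1 : HasDerivAt β (b s) s := d1 hs' 0 (by simp)
    have e2 : HasDerivAt Y (b s * y s) s := d2 hs' 0 (by simp)
    have e3 := e1.exp
    rw [(e3.fun_mul e2).deriv, e3.deriv]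
    have hfs := hf s hs
    have : Real.exp (β s) * b s * Y s + Real.exp (β s) * (b s * y s)
        = (Real.exp (β s) * b s) * f s := by rw [← hfs]; ring
    rw [this, mul_comm (f t)]
    exact mul_le_mul_of_nonneg_left (hmono s hs) (mul_nonneg (Real.exp_pos _).le (hs0 hs))
  rw [intervalIntegral.integral_const_mul, h1, h2, hY0, hβ0] at hle
  have hft := hf t (right_mem_Icc.2 ht)
  have hyt : y t = f t - Y t := by rw [← hft]; simp [hY]
  rw [hyt, Real.exp_neg]
  have hpos := Real.exp_pos (β t)
  have : f t * (Real.exp (β t))⁻¹ ≤ f t - Y t ↔ f t ≤ (f t - Y t) * Real.exp (β t) := by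
    rw [← div_eq_mul_inv, div_le_iff₀ hpos]
  rw [this]
  simp at hle
  nlinarith

theorem integral_primitive_mul_deriv {N η η' : ℝ → ℝ} {S : ℝ}
    (hN : IntervalIntegrable N volume 0 S) (hη : ∀ t, HasDerivAt η (η' t) t)
    (hη' : Continuous η') (hS : η S = 0) :
    ∫ t in (0 : ℝ)..S, (∫ s in (0 : ℝ)..t, N s) * η' t = -∫ t in (0 : ℝ)..S, N t * η t := by
  have acF : AbsolutelyContinuousOnInterval (fun t => ∫ s in (0 : ℝ)..t, N s) 0 S :=
    hN.absolutelyContinuousOnInterval_intervalIntegral (by simp)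
  have hder : deriv η = η' := funext fun t => (hη t).deriv
  have hC : ContDiff ℝ 1 η := contDiff_one_iff_deriv.2
    ⟨fun t => (hη t).differentiableAt, hder ▸ hη'⟩
  have acη : AbsolutelyContinuousOnInterval η 0 S :=
    hC.contDiffOn.absolutelyContinuousOnInterval
  have h := acF.integral_mul_deriv_eq_deriv_mul acη
  rw [hder] at h
  rw [h, hS]
  simp only [mul_zero, intervalIntegral.integral_same, zero_mul, sub_zero, zero_sub]
  congr 1
  refine intervalIntegral.integral_congr_ae ?_
  filter_upwards [hN.ae_hasDerivAt_integral] with s hs hs'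
  rw [(hs (uIoc_subset_uIcc hs') 0 (by simp)).deriv]

end Nakao

/-! ### The moment equation: monotonicity, positivity and exponential growth -/

namespace Nakao

theorem hasDerivAt_exp_mul (c s : ℝ) :
    HasDerivAt (fun s => Real.exp (c * s)) (c * Real.exp (c * s)) s := by
  have := (hasDerivAt_mul_const (x := s) c).exp
  simp only [mul_comm _ c] at this
  convert! this using 1

/-- `H` and `y = H'` satisfy `y' + b y = L H + N`, `y(0) = a` on `[0,S]`, in the form obtained by
testing with smooth functions of time. -/
structure IsMoment (S L a : ℝ) (b H y N : ℝ → ℝ) : Prop where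
  intb : IntervalIntegrable b volume 0 S
  intN : IntervalIntegrable N volume 0 S
  cont : ContinuousOn y (Icc 0 S)
  hasDeriv : ∀ t ∈ Icc 0 S, HasDerivWithinAt H (y t) (Icc 0 S) t
  identity : ∀ θ : ℝ → ℝ, ContDiff ℝ ∞ θ → ∀ t ∈ Icc 0 S,
    θ t * y t + ∫ s in (0 : ℝ)..t, (-(deriv θ s * y s) - L * (θ s * H s) + b s * (θ s * y s))
      = θ 0 * a + ∫ s in (0 : ℝ)..t, θ s * N s

namespace IsMoment

variable {S L a : ℝ} {b H y N : ℝ → ℝ}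

theorem contH (h : IsMoment S L a b H y N) : ContinuousOn H (Icc 0 S) :=
  fun t ht => (h.hasDeriv t ht).continuousWithinAt

theorem hasDerivAt (h : IsMoment S L a b H y N) {t : ℝ} (ht : t ∈ Ioo 0 S) :
    HasDerivAt H (y t) t :=
  (h.hasDeriv t (Ioo_subset_Icc_self ht)).hasDerivAt (Icc_mem_nhds ht.1 ht.2)

/-- The fundamental theorem of calculus for `g H`. -/
theorem integral_mul (h : IsMoment S L a b H y N) {g g' : ℝ → ℝ}
    (hg : ∀ t, HasDerivAt g (g' t) t) (hg' : Continuous g') {t : ℝ} (ht : t ∈ Icc 0 S) :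
    ∫ s in (0 : ℝ)..t, (g' s * H s + g s * y s) = g t * H t - g 0 * H 0 := by
  have hsub : Icc 0 t ⊆ Icc 0 S := Icc_subset_Icc_right ht.2
  have hgc : Continuous g := continuous_iff_continuousAt.2 fun t => (hg t).continuousAt
  refine intervalIntegral.integral_eq_sub_of_hasDerivAt_of_le (f := fun s => g s * H s) ht.1
    (hgc.continuousOn.mul (h.contH.mono hsub)) (fun s hs => ?_) ?_
  · exact (hg s).fun_mul (h.hasDerivAt ⟨hs.1, hs.2.trans_le ht.2⟩)
  · refine ContinuousOn.intervalIntegrable ?_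
    rw [uIcc_of_le ht.1]
    exact (hg'.continuousOn.mul (h.contH.mono hsub)).add
      (hgc.continuousOn.mul (h.cont.mono hsub))

theorem integral_eq (h : IsMoment S L a b H y N) {t : ℝ} (ht : t ∈ Icc 0 S) :
    ∫ s in (0 : ℝ)..t, y s = H t - H 0 := by
  have := h.integral_mul (g := fun _ => 1) (g' := fun _ => 0) (fun t => hasDerivAt_const _ _)
    continuous_const ht
  simpa using this

/-- While H' = y is nonnegative, H increases from H(0) ≥ 0, so a + L∫H + ∫N is nondecreasing and
`damped_lower_bound` applies; the term L∫H is then dropped. Sign information is required only before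
t, so that the result can be used at a first zero of y. -/
theorem le_of_nonneg (h : IsMoment S L a b H y N) (hL : 0 ≤ L)
    (hb0 : ∀ᵐ s : ℝ, s ∈ Icc 0 S → 0 ≤ b s) (hN : ∀ s, 0 ≤ N s) (hH : 0 ≤ H 0)
    {t : ℝ} (ht : t ∈ Icc 0 S) (hy : ∀ s ∈ Ico 0 t, 0 ≤ y s) :
    (∀ s ∈ Icc 0 t, H 0 ≤ H s) ∧
      (a + ∫ s in (0 : ℝ)..t, N s) * Real.exp (-∫ s in (0 : ℝ)..t, b s) ≤ y t := by
  have hsub : Icc 0 t ⊆ Icc 0 S := Icc_subset_Icc_right ht.2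
  have hinc : ∀ s ∈ Icc 0 t, H 0 ≤ H s := by
    intro s hs
    have h1 := h.integral_eq (hsub hs)
    have h2 : 0 ≤ ∫ r in (0 : ℝ)..s, y r := by
      rw [intervalIntegral.integral_of_le hs.1, ← integral_Ico_eq_integral_Ioc]
      exact setIntegral_nonneg measurableSet_Ico fun r hr => hy r ⟨hr.1, hr.2.trans_le hs.2⟩
    linarith
  refine ⟨hinc, ?_⟩
  have hii : ∀ s ∈ Icc 0 S, uIcc 0 s ⊆ uIcc 0 S := fun s hs => by
    rw [uIcc_of_le hs.1, uIcc_of_le (hs.1.trans hs.2)]; exact Icc_subset_Icc_right hs.2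
  have iN : ∀ s ∈ Icc 0 S, IntervalIntegrable N volume 0 s := fun s hs =>
    h.intN.mono_set (hii s hs)
  have iH : ∀ s ∈ Icc 0 S, IntervalIntegrable H volume 0 s := fun s hs =>
    ContinuousOn.intervalIntegrable (h.contH.mono (by
      rw [uIcc_of_le hs.1]; exact Icc_subset_Icc_right hs.2))
  have iby : ∀ s ∈ Icc 0 S, IntervalIntegrable (fun r => b r * y r) volume 0 s := fun s hs =>
    (h.intb.mono_set (hii s hs)).mul_continuousOn (h.cont.mono (by
      rw [uIcc_of_le hs.1]; exact Icc_subset_Icc_right hs.2))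
  have hid : ∀ s ∈ Icc 0 S, y s + ∫ r in (0 : ℝ)..s, b r * y r
      = a + L * (∫ r in (0 : ℝ)..s, H r) + ∫ r in (0 : ℝ)..s, N r := by
    intro s hs
    have := h.identity (fun _ => 1) contDiff_const s hs
    simp only [deriv_const', zero_mul, neg_zero, zero_sub, one_mul] at this
    have h2 := intervalIntegral.integral_add ((iH s hs).const_mul (-L)) (iby s hs)
    rw [intervalIntegral.integral_const_mul] at h2
    simp only [neg_mul] at h2
    linarith
  have hm : ∀ s ∈ Icc 0 t, (∫ r in (0 : ℝ)..s, H r) ≤ ∫ r in (0 : ℝ)..t, H r := fun s hs => by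
    refine intervalIntegral.integral_mono_interval le_rfl hs.1 hs.2 ?_ (iH t ht)
    filter_upwards [ae_restrict_mem measurableSet_Ioc] with r hr
    exact hH.trans (hinc r (Ioc_subset_Icc_self hr))
  have hmN : ∀ s ∈ Icc 0 t, (∫ r in (0 : ℝ)..s, N r) ≤ ∫ r in (0 : ℝ)..t, N r := fun s hs =>
    intervalIntegral.integral_mono_interval le_rfl hs.1 hs.2 (Eventually.of_forall hN) (iN t ht)
  have h0 : 0 ≤ ∫ r in (0 : ℝ)..t, H r := by
    have := hm 0 ⟨le_rfl, ht.1⟩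
    simpa using this
  have := damped_lower_bound (b := b) (y := y)
    (f := fun s => a + L * (∫ r in (0 : ℝ)..s, H r) + ∫ r in (0 : ℝ)..s, N r) ht.1
    (h.intb.mono_set (hii t ht)) (by filter_upwards [hb0] with s hs hs' using hs (hsub hs'))
    (h.cont.mono hsub) (fun s hs => hid s (hsub hs)) (fun s hs => by
      have := mul_le_mul_of_nonneg_left (hm s hs) hL
      have := hmN s hs
      linarith)
  refine le_trans ?_ this
  have : 0 ≤ L * ∫ r in (0 : ℝ)..t, H r := mul_nonneg hL h0
  gcongr
  linarith

/-- Continuity argument: at the first time where y ≤ 0, `le_of_nonneg` still gives y > 0 because a >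
0. -/
theorem pos (h : IsMoment S L a b H y N) (hL : 0 ≤ L)
    (hb0 : ∀ᵐ s : ℝ, s ∈ Icc 0 S → 0 ≤ b s) (hN : ∀ s, 0 ≤ N s) (hH : 0 ≤ H 0) (ha : 0 < a)
    {t : ℝ} (ht : t ∈ Icc 0 S) : 0 < y t := by
  by_contra hcon
  push Not at hcon
  have key : ∀ t ∈ Icc 0 S, (∀ s ∈ Ico 0 t, 0 ≤ y s) → 0 < y t := fun t ht hy => by
    refine lt_of_lt_of_le (mul_pos ?_ (Real.exp_pos _)) (h.le_of_nonneg hL hb0 hN hH ht hy).2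
    have : 0 ≤ ∫ s in (0 : ℝ)..t, N s := intervalIntegral.integral_nonneg ht.1 fun s _ => hN s
    linarith
  set Z : Set ℝ := Icc 0 S ∩ y ⁻¹' Iic 0 with hZ
  have hZc : IsClosed Z := h.cont.preimage_isClosed_of_isClosed isClosed_Icc isClosed_Iic
  have hZb : BddBelow Z := ⟨0, fun s hs => hs.1.1⟩
  have hmem : sInf Z ∈ Z := hZc.csInf_mem ⟨t, ht, hcon⟩ hZb
  have := key (sInf Z) hmem.1 (fun s hs => by
    by_contra hs'
    push Not at hs'
    have : s ∈ Z := ⟨⟨hs.1, hs.2.le.trans hmem.1.2⟩, hs'.le⟩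
    exact absurd (csInf_le hZb this) (not_le.2 hs.2))
  exact absurd hmem.2 (not_le.2 this)

/-- Factor the second-order operator: x = e^(-λt)(H' + λH) solves x' + bx = e^(-λt)(N + λbH), whose
right side is nonnegative, so x ≥ ma by `damped_lower_bound`. Then (e^(λt)H)' = e^(2λt)x ≥ ma
e^(2λt), and one integration gives the growth. -/
theorem growth {lam m : ℝ} (h : IsMoment S (lam ^ 2) a b H y N) (h1 : 1 ≤ lam) (h2 : lam ≤ 2)
    (hb0 : ∀ᵐ s : ℝ, s ∈ Icc 0 S → 0 ≤ b s) (hN : ∀ s, 0 ≤ N s) (hH : 0 ≤ H 0) (ha : 0 < a)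
    (hm0 : 0 ≤ m) (hm : ∀ t ∈ Icc 0 S, m ≤ Real.exp (-∫ s in (0 : ℝ)..t, b s))
    {t : ℝ} (ht : t ∈ Icc 1 S) : m / 8 * a * Real.exp (lam * t) ≤ H t := by
  have hlam : 0 < lam := by linarith
  have hii : ∀ s ∈ Icc 0 S, uIcc 0 s ⊆ uIcc 0 S := fun s hs => by
    rw [uIcc_of_le hs.1, uIcc_of_le (hs.1.trans hs.2)]; exact Icc_subset_Icc_right hs.2
  have hypos := fun s (hs : s ∈ Icc 0 S) => h.pos (sq_nonneg lam) hb0 hN hH ha hs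
  have hHpos : ∀ s ∈ Icc 0 S, 0 ≤ H s := fun s hs =>
    hH.trans ((h.le_of_nonneg (sq_nonneg lam) hb0 hN hH hs
      (fun r hr => (hypos r ⟨hr.1, hr.2.le.trans hs.2⟩).le)).1 s ⟨hs.1, le_rfl⟩)
  set e : ℝ → ℝ := fun s => Real.exp (-lam * s) with he
  have hec : Continuous e := by fun_prop
  have hde : ∀ s, HasDerivAt e (-(lam * e s)) s := fun s => by
    have := hasDerivAt_exp_mul (-lam) s
    rwa [neg_mul] at this
  have hesm : ContDiff ℝ ∞ e := by
    refine Real.contDiff_exp.comp ?_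
    exact contDiff_const.mul contDiff_id
  set x : ℝ → ℝ := fun s => e s * (y s + lam * H s) with hx
  have hsubu : ∀ s ∈ Icc 0 S, uIcc 0 s ⊆ Icc 0 S := fun s hs => by
    rw [uIcc_of_le hs.1]; exact Icc_subset_Icc_right hs.2
  have hcH := h.contH
  have hcy := h.cont
  have ib : ∀ s ∈ Icc 0 S, ∀ g : ℝ → ℝ, ContinuousOn g (Icc 0 S) →
      IntervalIntegrable (fun r => b r * g r) volume 0 s := fun s hs g hg =>
    (h.intb.mono_set (hii s hs)).mul_continuousOn (hg.mono (hsubu s hs))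
  have ic : ∀ s ∈ Icc 0 S, ∀ g : ℝ → ℝ, ContinuousOn g (Icc 0 S) →
      IntervalIntegrable g volume 0 s := fun s hs g hg =>
    (hg.mono (hsubu s hs)).intervalIntegrable
  have iN : ∀ s ∈ Icc 0 S, IntervalIntegrable (fun r => e r * N r) volume 0 s := fun s hs =>
    (h.intN.mono_set (hii s hs)).continuousOn_mul hec.continuousOn
  have hey : ContinuousOn (fun r => e r * y r) (Icc 0 S) := hec.continuousOn.mul hcy
  have heH : ContinuousOn (fun r => e r * H r) (Icc 0 S) := hec.continuousOn.mul hcH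
  have hxc : ContinuousOn x (Icc 0 S) :=
    hec.continuousOn.mul (hcy.add (continuousOn_const.mul hcH))
  have hid : ∀ s ∈ Icc 0 S, x s + ∫ r in (0 : ℝ)..s, b r * x r
      = (a + lam * H 0) + ∫ r in (0 : ℝ)..s, (e r * N r + lam * (b r * (e r * H r))) := by
    intro s hs
    have i1 := h.identity e hesm s hs
    have i2 := h.integral_mul hde (by fun_prop) hs
    have e0 : e 0 = 1 := by simp [he]
    rw [intervalIntegral.integral_add (iN s hs) ((ib s hs _ heH).const_mul lam)]
    have i3 : ∫ r in (0 : ℝ)..s, b r * x r = (∫ r in (0 : ℝ)..s, b r * (e r * y r))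
        + ∫ r in (0 : ℝ)..s, lam * (b r * (e r * H r)) := by
      rw [← intervalIntegral.integral_add (ib s hs _ hey) ((ib s hs _ heH).const_mul lam)]
      congr 1; ext r; simp only [hx]; ring
    have i4 : ∫ r in (0 : ℝ)..s,
        (-(deriv e r * y r) - lam ^ 2 * (e r * H r) + b r * (e r * y r))
        = lam * (∫ r in (0 : ℝ)..s, (-(lam * e r) * H r + e r * y r))
          + ∫ r in (0 : ℝ)..s, b r * (e r * y r) := by
      rw [← intervalIntegral.integral_const_mul, ← intervalIntegral.integral_add _ (ib s hs _ hey)]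
      · congr 1; ext r; rw [(hde r).deriv]; ring
      · refine ic s hs _ ?_
        exact continuousOn_const.mul ((by fun_prop : Continuous fun r => -(lam * e r)).continuousOn.mul
          hcH |>.add hey)
    rw [i4, i2, e0] at i1
    rw [i3]
    simp only [hx]
    linarith
  have hxlow : ∀ s ∈ Icc 0 S, m * a ≤ x s := by
    intro s hs
    have := damped_lower_bound (b := b) (y := x) (f := fun s => (a + lam * H 0) +
      ∫ r in (0 : ℝ)..s, (e r * N r + lam * (b r * (e r * H r)))) hs.1
      (h.intb.mono_set (hii s hs))
      (by filter_upwards [hb0] with r hr hr' using hr ⟨hr'.1, hr'.2.trans hs.2⟩)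
      (hxc.mono (Icc_subset_Icc_right hs.2)) (fun r hr => hid r ⟨hr.1, hr.2.trans hs.2⟩)
      (fun r hr => by
        refine add_le_add le_rfl (intervalIntegral.integral_mono_interval le_rfl hr.1 hr.2 ?_
          ((iN s hs).add ((ib s hs _ heH).const_mul lam)))
        rw [EventuallyLE, ae_restrict_iff' measurableSet_Ioc]
        filter_upwards [hb0] with r' hr' hr''
        have hm' : r' ∈ Icc 0 S := ⟨hr''.1.le, hr''.2.trans hs.2⟩
        have := hr' hm'
        have := hHpos r' hm'
        have := hN r'
        have : 0 < e r' := Real.exp_pos _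
        simp only [Pi.zero_apply]
        positivity)
    refine le_trans ?_ this
    have h0 : 0 ≤ ∫ r in (0 : ℝ)..s, (e r * N r + lam * (b r * (e r * H r))) := by
      refine intervalIntegral.integral_nonneg_of_ae_restrict hs.1 ?_
      rw [EventuallyLE, ae_restrict_iff' measurableSet_Icc]
      filter_upwards [hb0] with r' hr' hr''
      have hm' : r' ∈ Icc 0 S := ⟨hr''.1, hr''.2.trans hs.2⟩
      have := hr' hm'
      have := hHpos r' hm'
      have := hN r'
      have : 0 < e r' := Real.exp_pos _
      simp only [Pi.zero_apply]
      positivity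
    have h3 := hm s hs
    rw [mul_comm m]
    have : 0 ≤ lam * H 0 := by positivity
    exact mul_le_mul (by linarith) h3 hm0 (by linarith)
  have ht0 : t ∈ Icc 0 S := ⟨by linarith [ht.1], ht.2⟩
  have hg1 := hasDerivAt_exp_mul lam
  have hg2 := hasDerivAt_exp_mul (2 * lam)
  have i5 := h.integral_mul hg1 (by fun_prop) ht0
  have i6 : ∫ s in (0 : ℝ)..t, m * a * Real.exp (2 * lam * s)
      = m * a * ((Real.exp (2 * lam * t) - 1) / (2 * lam)) := by
    have : ∫ s in (0 : ℝ)..t, (2 * lam * Real.exp (2 * lam * s))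
        = Real.exp (2 * lam * t) - Real.exp (2 * lam * 0) :=
      intervalIntegral.integral_eq_sub_of_hasDerivAt (fun s _ => hg2 s)
        (Continuous.intervalIntegrable (by fun_prop) _ _)
    rw [intervalIntegral.integral_const_mul] at this ⊢
    rw [mul_zero, Real.exp_zero] at this
    rw [← this]
    field_simp
  have i7 : ∫ s in (0 : ℝ)..t, m * a * Real.exp (2 * lam * s) ≤
      ∫ s in (0 : ℝ)..t, (lam * Real.exp (lam * s) * H s + Real.exp (lam * s) * y s) := by
    refine intervalIntegral.integral_mono_on ht0.1
      (Continuous.intervalIntegrable (by fun_prop) _ _) (ic t ht0 _ ?_) fun s hs => ?_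
    · exact ((by fun_prop : Continuous fun s => lam * Real.exp (lam * s)).continuousOn.mul hcH).add
        ((by fun_prop : Continuous fun s => Real.exp (lam * s)).continuousOn.mul hcy)
    · have h3 := hxlow s ⟨hs.1, hs.2.trans ht.2⟩
      have h4 : Real.exp (2 * lam * s) = Real.exp (lam * s) * Real.exp (lam * s) := by
        rw [← Real.exp_add]; ring_nf
      have h5 : Real.exp (lam * s) * e s = 1 := by
        simp only [he]; rw [← Real.exp_add]; simp
      have h6 := mul_le_mul_of_nonneg_right h3
        (mul_pos (Real.exp_pos (lam * s)) (Real.exp_pos (lam * s))).le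
      rw [h4]
      refine h6.trans (le_of_eq ?_)
      simp only [hx]
      linear_combination (Real.exp (lam * s) * (y s + lam * H s)) * h5
  rw [i5, i6] at i7
  have h8 : Real.exp (2 * lam * t) = Real.exp (lam * t) * Real.exp (lam * t) := by
    rw [← Real.exp_add]; ring_nf
  have hlt : 1 ≤ lam * t := one_le_mul_of_one_le_of_one_le h1 ht.1
  have h9 : 2 ≤ Real.exp (lam * t) := by
    have := Real.add_one_le_exp (lam * t); linarith
  -- The constant 1/8: 2λ ≤ 4, and t ≥ 1 gives e^(λt) ≥ 2, so subtracting 1 from e^(2λt) loses at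
  -- most a factor 2.
  have h10 : m * a * (Real.exp (lam * t) * Real.exp (lam * t) / 8) ≤
      m * a * ((Real.exp (2 * lam * t) - 1) / (2 * lam)) := by
    refine mul_le_mul_of_nonneg_left ?_ (by positivity)
    rw [h8, div_le_div_iff₀ (by norm_num) (by positivity)]
    nlinarith
  have h11 : m / 8 * a * Real.exp (lam * t) * Real.exp (lam * t) ≤ H t * Real.exp (lam * t) := by
    have : 0 ≤ Real.exp (lam * 0) * H 0 := by positivity
    nlinarith
  exact le_of_mul_le_mul_right h11 (Real.exp_pos _)

end IsMoment

end Nakao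

/-! ### Testing the mean with powers of 1 - t/S -/

namespace Nakao

theorem hasDerivAt_one_sub_div_pow (S : ℝ) (k : ℕ) (t : ℝ) :
    HasDerivAt (fun t : ℝ => (1 - t / S) ^ (k + 1))
      (-((k + 1 : ℝ) / S) * (1 - t / S) ^ k) t := by
  have := (((hasDerivAt_id t).div_const S).const_sub 1).fun_pow (k + 1)
  simp only [id, Nat.cast_add, Nat.cast_one, Nat.add_sub_cancel] at this
  convert! this using 1
  ring

theorem contDiff_one_sub_div_pow (S : ℝ) (k : ℕ) :
    ContDiff ℝ ∞ (fun t : ℝ => (1 - t / S) ^ k) := by fun_prop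

namespace IsMoment

variable {S L a : ℝ} {b H y N : ℝ → ℝ}

/-- Two integrations by parts leave -θ' + θ'' against H; both powers j+2 and j+1 vanish at t = S,
and the boundary terms at 0 have a favourable sign because H(0) ≥ 0. The damping contributes 1/S and
the second derivative 1/S², which is absorbed since S ≥ 1. -/
theorem heat_estimate (h : IsMoment S 0 a (fun _ => 1) H y N) (hS : 1 ≤ S) (hH : 0 ≤ H 0)
    (j : ℕ) :
    (∫ t in (0 : ℝ)..S, (1 - t / S) ^ (j + 2) * N t) + a ≤
      2 * (j + 2) ^ 2 / S * ∫ t in (0 : ℝ)..S, |H t| * (1 - t / S) ^ j := by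
  have hS0 : 0 < S := by linarith
  have hSm : S ∈ Icc 0 S := ⟨hS0.le, le_rfl⟩
  set c1 : ℝ := (j + 1 + 1 : ℝ) / S with hc1
  set c2 : ℝ := (j + 1 : ℝ) / S with hc2
  have d0 : ∀ t, HasDerivAt (fun t : ℝ => (1 - t / S) ^ (j + 2)) (-c1 * (1 - t / S) ^ (j + 1)) t :=
    fun t => by
      have := hasDerivAt_one_sub_div_pow S (j + 1) t
      push_cast at this
      exact this
  have d1 : ∀ t, HasDerivAt (fun t : ℝ => (1 - t / S) ^ (j + 1)) (-c2 * (1 - t / S) ^ j) t :=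
    fun t => hasDerivAt_one_sub_div_pow S j t
  have i1 := h.identity _ (contDiff_one_sub_div_pow S (j + 2)) S hSm
  have i2 := h.integral_mul (fun t => (d0 t).fun_add ((d1 t).const_mul c1)) (by fun_prop) hSm
  have hcH : ContinuousOn H (uIcc 0 S) := by rw [uIcc_of_le hS0.le]; exact h.contH
  have hcy : ContinuousOn y (uIcc 0 S) := by rw [uIcc_of_le hS0.le]; exact h.cont
  have ii : ∀ g : ℝ → ℝ, Continuous g → ∀ f : ℝ → ℝ, ContinuousOn f (uIcc 0 S) →
      IntervalIntegrable (fun t => g t * f t) volume 0 S := fun g hg f hf =>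
    (hg.continuousOn.mul hf).intervalIntegrable
  rw [intervalIntegral.integral_add (ii _ (by fun_prop) _ hcH) (ii _ (by fun_prop) _ hcy)] at i2
  have i3 : ∫ s in (0 : ℝ)..S, (-(deriv (fun t : ℝ => (1 - t / S) ^ (j + 2)) s * y s)
      - 0 * ((1 - s / S) ^ (j + 2) * H s) + 1 * ((1 - s / S) ^ (j + 2) * y s)) =
      ∫ s in (0 : ℝ)..S, ((1 - s / S) ^ (j + 2) + c1 * (1 - s / S) ^ (j + 1)) * y s := by
    congr 1; ext s; rw [(d0 s).deriv]; ring
  rw [i3] at i1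
  have hdiv : S / S = 1 := div_self hS0.ne'
  simp only [hdiv, sub_self, zero_div, sub_zero, one_pow, ne_eq, Nat.add_eq_zero_iff, one_ne_zero,
    OfNat.ofNat_ne_zero, and_false, not_false_eq_true, zero_pow, zero_mul, zero_add, mul_zero,
    mul_one, one_mul] at i1 i2
  have i4 : -∫ t in (0 : ℝ)..S, (-c1 * (1 - t / S) ^ (j + 1) + c1 * (-c2 * (1 - t / S) ^ j)) * H t
      ≤ 2 * (j + 2) ^ 2 / S * ∫ t in (0 : ℝ)..S, |H t| * (1 - t / S) ^ j := by
    rw [← intervalIntegral.integral_const_mul, ← intervalIntegral.integral_neg]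
    refine intervalIntegral.integral_mono_on hS0.le (ii _ (by fun_prop) _ hcH).neg
      (ContinuousOn.intervalIntegrable (by fun_prop)) fun t ht => ?_
    have ht1 : t / S ≤ 1 := (div_le_one hS0).2 ht.2
    have ht0 : 0 ≤ t / S := div_nonneg ht.1 hS0.le
    have e1 : 0 ≤ (1 - t / S) ^ j := pow_nonneg (by linarith) _
    have e2 : (1 - t / S) ^ (j + 1) ≤ (1 - t / S) ^ j :=
      pow_le_pow_of_le_one (by linarith) (by linarith) (Nat.le_succ j)
    have e3 : 0 ≤ (1 - t / S) ^ (j + 1) := pow_nonneg (by linarith) _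
    have hc1' : 0 ≤ c1 := by positivity
    have hc2' : 0 ≤ c2 := by positivity
    have e4 : c1 * (1 - t / S) ^ (j + 1) + c1 * c2 * (1 - t / S) ^ j ≤
        (2 * (j + 2) ^ 2 / S) * (1 - t / S) ^ j := by
      have : c1 + c1 * c2 ≤ 2 * (j + 2) ^ 2 / S := by
        have hj : (0 : ℝ) ≤ j := Nat.cast_nonneg j
        have : c2 ≤ j + 1 := div_le_self (by positivity) hS
        calc c1 + c1 * c2 ≤ c1 + c1 * (j + 1) := by gcongr
          _ = (j + 2) * (j + 2) / S := by rw [hc1]; field_simp; ring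
          _ ≤ _ := div_le_div_of_nonneg_right (by nlinarith) hS0.le
      calc _ ≤ c1 * (1 - t / S) ^ j + c1 * c2 * (1 - t / S) ^ j := by gcongr
        _ = (c1 + c1 * c2) * (1 - t / S) ^ j := by ring
        _ ≤ _ := by gcongr
    calc _ = (c1 * (1 - t / S) ^ (j + 1) + c1 * c2 * (1 - t / S) ^ j) * H t := by ring
      _ ≤ (c1 * (1 - t / S) ^ (j + 1) + c1 * c2 * (1 - t / S) ^ j) * |H t| := by
          gcongr
          exact le_abs_self _
      _ ≤ ((2 * (j + 2) ^ 2 / S) * (1 - t / S) ^ j) * |H t| := by gcongr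
      _ = _ := by ring
  have : 0 ≤ c1 * H 0 := mul_nonneg (by positivity) hH
  linarith

/-- Direct testing would leave a term θbH' that H cannot control, b being only integrable. Instead
the pointwise bound H'(t) ≥ m(a + ∫₀ᵗN) is integrated against -θ' ≥ 0. Parts on the left restores
∫θN + a; parts on the right gives θ''H and hence S⁻². -/
theorem wave_estimate {m : ℝ} (h : IsMoment S 0 a b H y N) (hS : 0 < S)
    (hb0 : ∀ᵐ s : ℝ, s ∈ Icc 0 S → 0 ≤ b s) (hN : ∀ s, 0 ≤ N s) (hH : 0 ≤ H 0) (ha : 0 < a)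
    (hm : ∀ t ∈ Icc 0 S, m ≤ Real.exp (-∫ s in (0 : ℝ)..t, b s)) (j : ℕ) :
    m * ((∫ t in (0 : ℝ)..S, (1 - t / S) ^ (j + 2) * N t) + a) ≤
      (j + 2) ^ 2 / S ^ 2 * ∫ t in (0 : ℝ)..S, |H t| * (1 - t / S) ^ j := by
  have hSm : S ∈ Icc 0 S := ⟨hS.le, le_rfl⟩
  set c1 : ℝ := (j + 1 + 1 : ℝ) / S with hc1
  set c2 : ℝ := (j + 1 : ℝ) / S with hc2
  have hc1' : 0 ≤ c1 := by positivity
  have hc2' : 0 ≤ c2 := by positivity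
  have d0 : ∀ t, HasDerivAt (fun t : ℝ => (1 - t / S) ^ (j + 2)) (-c1 * (1 - t / S) ^ (j + 1)) t :=
    fun t => by
      have := hasDerivAt_one_sub_div_pow S (j + 1) t
      push_cast at this
      exact this
  have d1 : ∀ t, HasDerivAt (fun t : ℝ => (1 - t / S) ^ (j + 1)) (-c2 * (1 - t / S) ^ j) t :=
    fun t => hasDerivAt_one_sub_div_pow S j t
  have hcH : ContinuousOn H (uIcc 0 S) := by rw [uIcc_of_le hS.le]; exact h.contH
  have hcy : ContinuousOn y (uIcc 0 S) := by rw [uIcc_of_le hS.le]; exact h.cont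
  have ii : ∀ g : ℝ → ℝ, Continuous g → ∀ f : ℝ → ℝ, ContinuousOn f (uIcc 0 S) →
      IntervalIntegrable (fun t => g t * f t) volume 0 S := fun g hg f hf =>
    (hg.continuousOn.mul hf).intervalIntegrable
  have hdiv : S / S = 1 := div_self hS.ne'
  have i2 := h.integral_mul (fun t => (d1 t).const_mul c1) (by fun_prop) hSm
  rw [intervalIntegral.integral_add (ii _ (by fun_prop) _ hcH) (ii _ (by fun_prop) _ hcy)] at i2
  simp only [hdiv, sub_self, zero_div, sub_zero, one_pow, ne_eq, Nat.add_eq_zero_iff, one_ne_zero,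
    and_false, not_false_eq_true, zero_pow, zero_mul, mul_zero, mul_one, zero_sub] at i2
  have hint := h.intN.absolutelyContinuousOnInterval_intervalIntegral
    (c := 0) (by simp) |>.continuousOn
  have i3 := integral_primitive_mul_deriv h.intN d0 (by fun_prop)
    (by simp [hdiv])
  have i4 : ∫ t in (0 : ℝ)..S, -c1 * (1 - t / S) ^ (j + 1) = -1 := by
    rw [intervalIntegral.integral_eq_sub_of_hasDerivAt (fun t _ => d0 t)
      (Continuous.intervalIntegrable (by fun_prop) _ _)]
    simp [hdiv]
  have i5 : m * ((∫ t in (0 : ℝ)..S, (1 - t / S) ^ (j + 2) * N t) + a) =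
      ∫ t in (0 : ℝ)..S, m * ((a + ∫ s in (0 : ℝ)..t, N s) * (c1 * (1 - t / S) ^ (j + 1))) := by
    rw [intervalIntegral.integral_const_mul]
    congr 1
    have e1 : ∫ t in (0 : ℝ)..S, ((a + ∫ s in (0 : ℝ)..t, N s) * (c1 * (1 - t / S) ^ (j + 1))) =
        (∫ t in (0 : ℝ)..S, -a * (-c1 * (1 - t / S) ^ (j + 1))) -
        ∫ t in (0 : ℝ)..S, (∫ s in (0 : ℝ)..t, N s) * (-c1 * (1 - t / S) ^ (j + 1)) := by
      rw [← intervalIntegral.integral_sub (Continuous.intervalIntegrable (by fun_prop) _ _)]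
      · congr 1; ext t; ring
      · exact (hint.mul (by fun_prop)).intervalIntegrable
    rw [e1, i3, intervalIntegral.integral_const_mul, i4]
    have : ∀ t, N t * (1 - t / S) ^ (j + 2) = (1 - t / S) ^ (j + 2) * N t := fun t => mul_comm _ _
    simp only [this]
    ring
  have i6 : ∫ t in (0 : ℝ)..S, m * ((a + ∫ s in (0 : ℝ)..t, N s) * (c1 * (1 - t / S) ^ (j + 1)))
      ≤ ∫ t in (0 : ℝ)..S, (c1 * (1 - t / S) ^ (j + 1)) * y t := by
    refine intervalIntegral.integral_mono_on hS.le ?_ (ii _ (by fun_prop) _ hcy) fun t ht => ?_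
    · exact (continuousOn_const.mul ((continuousOn_const.add hint).mul
        (by fun_prop))).intervalIntegrable
    · have ht1 : t / S ≤ 1 := (div_le_one hS).2 ht.2
      have e1 : 0 ≤ (1 - t / S) ^ (j + 1) := pow_nonneg (by linarith) _
      have e2 := (h.le_of_nonneg le_rfl hb0 hN hH ht (fun s hs =>
        (h.pos le_rfl hb0 hN hH ha ⟨hs.1, hs.2.le.trans ht.2⟩).le)).2
      have e3 : 0 ≤ ∫ s in (0 : ℝ)..t, N s := intervalIntegral.integral_nonneg ht.1 fun s _ => hN s
      have e4 : m * (a + ∫ s in (0 : ℝ)..t, N s) ≤ y t := by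
        refine le_trans ?_ e2
        rw [mul_comm]
        exact mul_le_mul_of_nonneg_left (hm t ht) (by linarith)
      calc _ = (c1 * (1 - t / S) ^ (j + 1)) * (m * (a + ∫ s in (0 : ℝ)..t, N s)) := by ring
        _ ≤ _ := by gcongr
  have i7 : -∫ t in (0 : ℝ)..S, (c1 * (-c2 * (1 - t / S) ^ j)) * H t
      ≤ (j + 2) ^ 2 / S ^ 2 * ∫ t in (0 : ℝ)..S, |H t| * (1 - t / S) ^ j := by
    rw [← intervalIntegral.integral_const_mul, ← intervalIntegral.integral_neg]
    refine intervalIntegral.integral_mono_on hS.le (ii _ (by fun_prop) _ hcH).neg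
      (ContinuousOn.intervalIntegrable (by fun_prop)) fun t ht => ?_
    have ht1 : t / S ≤ 1 := (div_le_one hS).2 ht.2
    have e1 : 0 ≤ (1 - t / S) ^ j := pow_nonneg (by linarith) _
    have e4 : c1 * c2 ≤ (j + 2) ^ 2 / S ^ 2 := by
      have hj : (0 : ℝ) ≤ j := Nat.cast_nonneg j
      rw [hc1, hc2, div_mul_div_comm, ← sq S]
      gcongr
      nlinarith
    calc _ = (c1 * c2 * (1 - t / S) ^ j) * H t := by ring
      _ ≤ (c1 * c2 * (1 - t / S) ^ j) * |H t| := by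
          gcongr
          exact le_abs_self _
      _ ≤ ((j + 2) ^ 2 / S ^ 2 * (1 - t / S) ^ j) * |H t| := by gcongr
      _ = _ := by ring
  have : 0 ≤ c1 * H 0 := mul_nonneg hc1' hH
  rw [i5]
  linarith

end IsMoment

end Nakao

/-! ### Spatial integration by parts against plane exponentials -/

namespace Nakao

variable {n : ℕ}

theorem inner_gradient {G : Space n → ℝ} (x y : Space n) :
    inner ℝ (gradient G x) y = fderiv ℝ G x y := by
  simp [gradient]

theorem contDiff_gradient {G : Space n → ℝ} (hG : ContDiff ℝ ∞ G) :
    ContDiff ℝ ∞ (gradient G) := by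
  have h1 : ContDiff ℝ ∞ (fderiv ℝ G) := hG.fderiv_right (by simp)
  exact (InnerProductSpace.toDual ℝ (Space n)).symm.contDiff.comp h1

theorem hasCompactSupport_gradient {G : Space n → ℝ} (hG : HasCompactSupport G) :
    HasCompactSupport (gradient G) :=
  (hG.fderiv (𝕜 := ℝ)).comp_left (g := (InnerProductSpace.toDual ℝ (Space n)).symm) (map_zero _)

theorem integrable_inner_of_locallyIntegrable {g F : Space n → Space n}
    (hg : LocallyIntegrable g) (hF : Continuous F) (hFc : HasCompactSupport F) :
    Integrable (fun x => inner ℝ (g x) (F x)) := by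
  have h1 : IntegrableOn g (tsupport F) := hg.integrableOn_isCompact hFc
  obtain ⟨M, hM⟩ := hFc.exists_bound_of_continuous hF
  have h2 : IntegrableOn (fun x => inner ℝ (g x) (F x)) (tsupport F) := by
    refine Integrable.mono' (h1.norm.mul_const M)
      (h1.aestronglyMeasurable.inner hF.aestronglyMeasurable) (Eventually.of_forall fun x => ?_)
    refine (norm_inner_le_norm _ _).trans ?_
    gcongr
    exact hM x
  rw [integrableOn_iff_integrable_of_support_subset] at h2
  · exact h2
  · intro x hx
    by_contra hx'
    exact hx (by simp [image_eq_zero_of_notMem_tsupport hx'])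

theorem integrable_mul_of_locallyIntegrable {f F : Space n → ℝ}
    (hf : LocallyIntegrable f) (hF : Continuous F) (hFc : HasCompactSupport F) :
    Integrable (fun x => f x * F x) := by
  simpa [smul_eq_mul, mul_comm] using hf.integrable_smul_left_of_hasCompactSupport hF hFc

/-- Integration by parts against the gradient of a test function. -/
theorem HasWeakGradient.integral_inner_gradient {f : Space n → ℝ} {g : Space n → Space n}
    (h : HasWeakGradient f g) {G : Space n → ℝ} (hG : ContDiff ℝ ∞ G) (hGc : HasCompactSupport G) :
    ∫ x, inner ℝ (g x) (gradient G x) =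
      -∫ x, f x * ∑ i, fderiv ℝ (fun z => fderiv ℝ G z (EuclideanSpace.single i 1)) x
        (EuclideanSpace.single i 1) := by
  have hsm : ∀ i : Fin n, ContDiff ℝ ∞ (fun z => fderiv ℝ G z (EuclideanSpace.single i 1)) :=
    fun i => (hG.fderiv_right (by simp)).clm_apply contDiff_const
  have hcs : ∀ i : Fin n, HasCompactSupport (fun z => fderiv ℝ G z (EuclideanSpace.single i 1)) :=
    fun i => hGc.fderiv_apply (𝕜 := ℝ) _
  -- The weak-gradient identity is vector valued: take ∂ᵢG as test function, keep the i-th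
  -- component, and sum over i.
  have key : ∀ i : Fin n,
      ∫ x, f x * fderiv ℝ (fun z => fderiv ℝ G z (EuclideanSpace.single i 1)) x
        (EuclideanSpace.single i 1) =
      -∫ x, fderiv ℝ G x (EuclideanSpace.single i 1) * (g x) i := by
    intro i
    have h1 := h.2.2 _ (hsm i) (hcs i)
    have i1 : Integrable (fun x => f x •
        gradient (fun z => fderiv ℝ G z (EuclideanSpace.single i 1)) x) :=
      h.1.integrable_smul_right_of_hasCompactSupport (contDiff_gradient (hsm i)).continuous
        (hasCompactSupport_gradient (hcs i))
    have i2 : Integrable (fun x => fderiv ℝ G x (EuclideanSpace.single i 1) • g x) :=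
      h.2.1.integrable_smul_left_of_hasCompactSupport (hsm i).continuous (hcs i)
    have h2 := congrArg (fun z => inner ℝ (EuclideanSpace.single i (1 : ℝ)) z) h1
    simp only [inner_neg_right] at h2
    rw [← integral_inner i1, ← integral_inner i2] at h2
    simp only [inner_smul_right] at h2
    have s1 : ∀ (φ : Space n → ℝ) x, inner ℝ (EuclideanSpace.single i (1 : ℝ)) (gradient φ x)
        = fderiv ℝ φ x (EuclideanSpace.single i 1) := fun φ x => by
      rw [real_inner_comm, inner_gradient]
    simp only [s1, EuclideanSpace.inner_single_left, map_one, one_mul] at h2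
    exact h2
  have iL : ∀ i : Fin n, Integrable (fun x => f x *
      fderiv ℝ (fun z => fderiv ℝ G z (EuclideanSpace.single i 1)) x
        (EuclideanSpace.single i 1)) := fun i =>
    integrable_mul_of_locallyIntegrable h.1
      (((hsm i).fderiv_right (m := ∞) (by simp)).clm_apply contDiff_const).continuous
      ((hcs i).fderiv_apply (𝕜 := ℝ) _)
  have iR : ∀ i : Fin n, Integrable (fun x =>
      fderiv ℝ G x (EuclideanSpace.single i 1) * (g x) i) := fun i => by
    have i2 : Integrable (fun x => fderiv ℝ G x (EuclideanSpace.single i 1) • g x) :=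
      h.2.1.integrable_smul_left_of_hasCompactSupport (hsm i).continuous (hcs i)
    have i3 := i2.const_inner (𝕜 := ℝ) (EuclideanSpace.single i (1 : ℝ))
    simpa only [inner_smul_right, EuclideanSpace.inner_single_left, map_one, one_mul] using i3
  simp only [Finset.mul_sum]
  rw [integral_finsetSum _ (fun i _ => iL i), ← Finset.sum_neg_distrib]
  simp only [key, neg_neg]
  rw [← integral_finsetSum _ (fun i _ => iR i)]
  congr 1; ext x
  rw [PiLp.inner_apply]
  refine Finset.sum_congr rfl fun i _ => ?_
  rw [← inner_gradient, EuclideanSpace.inner_single_right]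
  simp

/-- The plane exponential is smooth. -/
theorem contDiff_exp_inner (ξ : Space n) :
    ContDiff ℝ ∞ (fun x : Space n => Real.exp (inner ℝ x ξ)) :=
  Real.contDiff_exp.comp (contDiff_id.inner ℝ contDiff_const)

theorem fderiv_exp_inner (ξ x y : Space n) :
    fderiv ℝ (fun x : Space n => Real.exp (inner ℝ x ξ)) x y
      = inner ℝ y ξ * Real.exp (inner ℝ x ξ) := by
  have h : HasFDerivAt (fun x : Space n => inner ℝ x ξ) (innerSL ℝ ξ) x := by
    have := (innerSL ℝ ξ).hasFDerivAt (x := x)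
    refine this.congr_of_eventuallyEq (Eventually.of_forall fun z => ?_)
    simp [real_inner_comm]
  rw [h.exp.fderiv]
  simp [real_inner_comm, mul_comm]

/-- Only the germ at x matters, so a cut-off exponential satisfies Δe^(x·ξ) = |ξ|²e^(x·ξ) wherever
the cut-off is locally 1. -/
theorem laplacian_of_eventuallyEq_exp_inner {G : Space n → ℝ} {ξ x : Space n}
    (h : G =ᶠ[𝓝 x] fun x => Real.exp (inner ℝ x ξ)) :
    ∑ i, fderiv ℝ (fun z => fderiv ℝ G z (EuclideanSpace.single i 1)) x
        (EuclideanSpace.single i 1) = ‖ξ‖ ^ 2 * Real.exp (inner ℝ x ξ) := by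
  have key : ∀ i : Fin n, fderiv ℝ (fun z => fderiv ℝ G z (EuclideanSpace.single i 1)) x
        (EuclideanSpace.single i 1) = (ξ i) ^ 2 * Real.exp (inner ℝ x ξ) := fun i => by
    have h1 : (fun z => fderiv ℝ G z (EuclideanSpace.single i 1)) =ᶠ[𝓝 x]
        fun z => ξ i * Real.exp (inner ℝ z ξ) := by
      filter_upwards [h.fderiv (𝕜 := ℝ)] with z hz
      rw [hz, fderiv_exp_inner, EuclideanSpace.inner_single_left]
      simp
    rw [h1.fderiv_eq, fderiv_const_mul
      ((contDiff_exp_inner ξ).differentiable (by simp) x)]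
    rw [smul_apply, fderiv_exp_inner, EuclideanSpace.inner_single_left]
    simp
    ring
  simp only [key]
  rw [← Finset.sum_mul, EuclideanSpace.norm_sq_eq]
  simp

end Nakao

/-! ### From weak solutions to moment equations -/

namespace Nakao

variable {n : ℕ} {T : EReal} {S R : ℝ}

theorem Icc_subset_times (hST : (S : EReal) < T) : Icc 0 S ⊆ times T := fun _ ht =>
  ⟨ht.1, (EReal.coe_le_coe_iff.2 ht.2).trans_lt hST⟩

theorem abs_integral_mul_le {f F : Space n → ℝ} (hf : LocallyIntegrable f)
    (hFc : HasCompactSupport F) {M : ℝ} (hM : ∀ x, ‖F x‖ ≤ M) :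
    |∫ x, f x * F x| ≤ M * ∫ x in tsupport F, ‖f x‖ := by
  have h1 : IntegrableOn f (tsupport F) := hf.integrableOn_isCompact hFc
  have h2 : ∫ x, f x * F x = ∫ x in tsupport F, f x * F x := by
    refine (setIntegral_eq_integral_of_forall_compl_eq_zero fun x hx => ?_).symm
    rw [image_eq_zero_of_notMem_tsupport hx, mul_zero]
  rw [h2, ← integral_const_mul, ← Real.norm_eq_abs]
  refine norm_integral_le_of_norm_le (h1.norm.const_mul M) (Eventually.of_forall fun x => ?_)
  rw [norm_mul, mul_comm]
  gcongr
  exact hM x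

theorem ContL1loc.continuousOn_integral {f : ℝ → Space n → ℝ} (hf : ContL1loc T f)
    {G : Space n → ℝ} (hG : Continuous G) (hGc : HasCompactSupport G) :
    ContinuousOn (fun t => ∫ x, f t x * G x) (times T) := by
  obtain ⟨M, hM⟩ := hGc.exists_bound_of_continuous hG
  intro t₀ ht₀
  have h1 := (hf.2 t₀ ht₀ (tsupport G) hGc).const_mul M
  rw [mul_zero] at h1
  rw [ContinuousWithinAt, tendsto_iff_norm_sub_tendsto_zero]
  refine squeeze_zero' (Eventually.of_forall fun t => norm_nonneg _) ?_ h1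
  filter_upwards [self_mem_nhdsWithin] with t ht
  rw [← integral_sub (integrable_mul_of_locallyIntegrable (hf.1 t ht) hG hGc)
    (integrable_mul_of_locallyIntegrable (hf.1 t₀ ht₀) hG hGc)]
  simp only [← sub_mul]
  exact abs_integral_mul_le ((hf.1 t ht).sub (hf.1 t₀ ht₀)) hGc hM

theorem HasTimeDeriv.hasDerivWithinAt_integral {f f' : ℝ → Space n → ℝ} (hf : HasTimeDeriv T f f')
    {G : Space n → ℝ} (hG : Continuous G) (hGc : HasCompactSupport G) {t₀ : ℝ}
    (ht₀ : t₀ ∈ times T) :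
    HasDerivWithinAt (fun t => ∫ x, f t x * G x) (∫ x, f' t₀ x * G x) (times T) t₀ := by
  obtain ⟨M, hM⟩ := hGc.exists_bound_of_continuous hG
  have h1 := (hf.2.2 t₀ ht₀ (tsupport G) hGc).const_mul M
  rw [mul_zero] at h1
  rw [hasDerivWithinAt_iff_tendsto_slope, tendsto_iff_norm_sub_tendsto_zero]
  refine squeeze_zero' (Eventually.of_forall fun t => norm_nonneg _) ?_ h1
  filter_upwards [self_mem_nhdsWithin] with t ht
  have i1 := integrable_mul_of_locallyIntegrable (hf.1.1 t ht.1) hG hGc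
  have i2 := integrable_mul_of_locallyIntegrable (hf.1.1 t₀ ht₀) hG hGc
  have i3 := integrable_mul_of_locallyIntegrable (hf.2.1.1 t₀ ht₀) hG hGc
  have e : slope (fun t => ∫ x, f t x * G x) t₀ t - ∫ x, f' t₀ x * G x
      = ∫ x, ((f t x - f t₀ x) / (t - t₀) - f' t₀ x) * G x := by
    have i4 : Integrable (fun x => (f t x * G x - f t₀ x * G x) / (t - t₀)) :=
      (i1.sub i2).div_const _
    rw [slope_def_field, ← integral_sub i1 i2, ← integral_div, ← integral_sub i4 i3]
    congr 1; ext x; ring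
  rw [e]
  refine abs_integral_mul_le ?_ hGc hM
  have := (((hf.1.1 t ht.1).sub (hf.1.1 t₀ ht₀)).smul ((t - t₀)⁻¹)).sub (hf.2.1.1 t₀ ht₀)
  refine this.congr (Eventually.of_forall fun x => ?_)
  simp [div_eq_inv_mul]

/-- Exponential moments of a weak solution of a damped wave equation. -/
theorem isMoment_of_weakIdentity {w w' h : ℝ → Space n → ℝ} {Dw : ℝ → Space n → Space n}
    {w₁ : Space n → ℝ} {β : ℝ → ℝ} (hS : 0 < S) (hST : (S : EReal) < T) (hR : 0 < R)
    (hg : HasSpaceGradient T w Dw) (ht : HasTimeDeriv T w w')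
    (hw : WeakIdentity T β w' Dw w₁ h)
    (hsupp : ∀ t ∈ Icc 0 S, SuppInBall (R + S) (w t))
    (hw₁ : SuppInBall (R + S) w₁)
    (hh : ∀ t ∈ Ioc 0 S, SuppInBall (R + S) (h t))
    (hhi : IntegrableOn (fun z : ℝ × Space n => h z.1 z.2)
      (Icc 0 S ×ˢ Metric.closedBall 0 (R + S)))
    (hβ : IntervalIntegrable β volume 0 S) (ξ : Space n) :
    ∃ y, IsMoment S (‖ξ‖ ^ 2) (∫ x, w₁ x * Real.exp (inner ℝ x ξ)) β
      (fun t => ∫ x, w t x * Real.exp (inner ℝ x ξ)) y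
      (fun t => ∫ x, h t x * Real.exp (inner ℝ x ξ)) := by
  -- Times S < S₁ < S₂ < T leave room for a time cut-off κ that is 1 around [0,S] and supported
  -- before T. The spatial cut-off χ is 1 around the ball of radius R + S, so its derivatives never
  -- meet the support of w.
  obtain ⟨S₂, hS₂, hS₂T⟩ := EReal.lt_iff_exists_real_btwn.1 hST
  obtain ⟨S₁, hS₁, hS₁₂⟩ := EReal.lt_iff_exists_real_btwn.1 hS₂
  rw [EReal.coe_lt_coe_iff] at hS₁ hS₁₂
  let χ : ContDiffBump (0 : Space n) := ⟨R + S + 1, R + S + 2, by positivity, by linarith⟩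
  let κ : ContDiffBump (0 : ℝ) := ⟨S₁, S₂, by linarith, hS₁₂⟩
  set E : Space n → ℝ := fun x => Real.exp (inner ℝ x ξ) with hE
  have hEs : ContDiff ℝ ∞ E := contDiff_exp_inner ξ
  set G : Space n → ℝ := fun x => χ x * E x with hGdef
  have hG : ContDiff ℝ ∞ G := χ.contDiff.mul hEs
  have hGc : HasCompactSupport G := χ.hasCompactSupport.mul_right
  have hGE : ∀ x, ‖x‖ ≤ R + S → G =ᶠ[𝓝 x] E := fun x hx => by
    have : x ∈ Metric.ball (0 : Space n) χ.rIn := by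
      rw [mem_ball_zero_iff]; change ‖x‖ < R + S + 1; linarith
    filter_upwards [χ.eventuallyEq_one_of_mem_ball this] with z hz
    simp [hGdef, hz]
  have hcut : ∀ f : Space n → ℝ, SuppInBall (R + S) f →
      ∫ x, f x * G x = ∫ x, f x * E x := fun f hf => by
    refine integral_congr_ae ?_
    filter_upwards [hf] with x hx
    by_cases hxr : ‖x‖ ≤ R + S
    · simp only [(hGE x hxr).eq_of_nhds]
    · simp [hx (not_le.1 hxr)]
  set y : ℝ → ℝ := fun t => ∫ x, w' t x * G x with hy
  have hsub := Icc_subset_times hST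
  have hyc : ContinuousOn y (Icc 0 S) :=
    (ht.2.1.continuousOn_integral hG.continuous hGc).mono hsub
  have hder : ∀ t ∈ Icc 0 S, HasDerivWithinAt (fun t => ∫ x, w t x * E x) (y t) (Icc 0 S) t :=
    fun t htS => ((ht.hasDerivWithinAt_integral hG.continuous hGc (hsub htS)).mono hsub).congr
      (fun s hs => (hcut _ (hsupp s hs)).symm) (hcut _ (hsupp t htS)).symm
  have hHc : ContinuousOn (fun t => ∫ x, w t x * E x) (Icc 0 S) :=
    fun t ht => (hder t ht).continuousWithinAt
  have hNi : IntervalIntegrable (fun t => ∫ x, h t x * E x) volume 0 S := by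
    rw [intervalIntegrable_iff_integrableOn_Ioc_of_le hS.le]
    have h1 : IntegrableOn (fun z : ℝ × Space n => h z.1 z.2 * E z.2)
        (Icc 0 S ×ˢ Metric.closedBall 0 (R + S)) :=
      hhi.mul_continuousOn (hEs.continuous.comp continuous_snd).continuousOn
        (isCompact_Icc.prod (isCompact_closedBall _ _))
    rw [IntegrableOn, Measure.volume_eq_prod, ← Measure.prod_restrict] at h1
    have h2 := h1.integral_prod_left
    refine (IntegrableOn.mono_set (s := Ioc 0 S) h2 Ioc_subset_Icc_self).congr_fun_ae ?_
    filter_upwards [ae_restrict_mem measurableSet_Ioc] with t ht'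
    refine setIntegral_eq_integral_of_ae_compl_eq_zero ?_
    filter_upwards [hh t ht'] with x hx hx'
    rw [hx (by simpa using hx'), zero_mul]
  have hpos : ∀ θ : ℝ → ℝ, ContDiff ℝ ∞ θ → ∀ t ∈ Ioc 0 S,
      θ t * y t + ∫ s in (0 : ℝ)..t, (-(deriv θ s * y s) -
        ‖ξ‖ ^ 2 * (θ s * ∫ x, w s x * E x) + β s * (θ s * y s))
      = θ 0 * (∫ x, w₁ x * E x) + ∫ s in (0 : ℝ)..t, θ s * ∫ x, h s x * E x := by
    intro θ hθ t ht'
    set φ : ℝ → Space n → ℝ := fun s x => (θ s * κ s) * G x with hφ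
    have hsup : Function.support (fun z : ℝ × Space n => φ z.1 z.2) ⊆
        Metric.closedBall 0 S₂ ×ˢ tsupport G := fun z hz => by
      refine ⟨?_, ?_⟩
      · by_contra hz'
        refine hz ?_
        have : κ z.1 = 0 := κ.zero_of_le_dist (by
          rw [Metric.mem_closedBall, not_le] at hz'; exact hz'.le)
        simp [hφ, this]
      · by_contra hz'
        refine hz ?_
        simp [hφ, image_eq_zero_of_notMem_tsupport hz']
    have htest : IsTest T φ := by
      refine ⟨?_, ?_, fun z hz => ?_⟩
      · exact ((hθ.mul κ.contDiff).comp contDiff_fst).mul (hG.comp contDiff_snd)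
      · exact HasCompactSupport.of_support_subset_isCompact
          ((isCompact_closedBall _ _).prod hGc) hsup
      · have := closure_minimal hsup (Metric.isClosed_closedBall.prod (isClosed_tsupport _)) hz
        have h1 := this.1
        rw [mem_closedBall_zero_iff, Real.norm_eq_abs] at h1
        exact (EReal.coe_le_coe_iff.2 ((le_abs_self _).trans h1)).trans_lt hS₂T
    have hκ : ∀ s ∈ Icc 0 S, (fun s => θ s * κ s) =ᶠ[𝓝 s] θ := fun s hs => by
      have : s ∈ Metric.ball (0 : ℝ) κ.rIn := by
        rw [mem_ball_zero_iff, Real.norm_eq_abs, abs_of_nonneg hs.1]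
        exact hs.2.trans_lt hS₁
      filter_upwards [κ.eventuallyEq_one_of_mem_ball this] with z hz
      simp [hz]
    have hφs : ∀ s ∈ Icc 0 S, ∀ x, φ s x = θ s * G x := fun s hs x => by
      simp only [hφ, (hκ s hs).eq_of_nhds]
    have h1 := hw φ htest t ht'.1 ((EReal.coe_le_coe_iff.2 ht'.2).trans_lt hST)
    have htm : t ∈ Icc 0 S := Ioc_subset_Icc_self ht'
    have e1 : ∫ x, w' t x * φ t x = θ t * y t := by
      rw [hy, ← integral_const_mul]
      congr 1; ext x; rw [hφs t htm]; ring
    have e2 : ∫ x, w₁ x * φ 0 x = θ 0 * ∫ x, w₁ x * E x := by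
      rw [← hcut _ hw₁, ← integral_const_mul]
      congr 1; ext x; rw [hφs 0 ⟨le_rfl, hS.le⟩]; ring
    have e3 : ∫ s in (0 : ℝ)..t, ∫ x, h s x * φ s x =
        ∫ s in (0 : ℝ)..t, θ s * ∫ x, h s x * E x := by
      refine intervalIntegral.integral_congr_ae (Eventually.of_forall fun s hs => ?_)
      rw [uIoc_of_le ht'.1.le] at hs
      have hs' : s ∈ Ioc 0 S := ⟨hs.1, hs.2.trans ht'.2⟩
      rw [← hcut _ (hh s hs'), ← integral_const_mul]
      congr 1; ext x; rw [hφs s (Ioc_subset_Icc_self hs')]; ring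
    have e4 : ∫ s in (0 : ℝ)..t, ∫ x, (-(w' s x * deriv (fun r => φ r x) s)
          + inner ℝ (Dw s x) (gradient (φ s) x) + β s * w' s x * φ s x) =
        ∫ s in (0 : ℝ)..t, (-(deriv θ s * y s) -
          ‖ξ‖ ^ 2 * (θ s * ∫ x, w s x * E x) + β s * (θ s * y s)) := by
      refine intervalIntegral.integral_congr fun s hs => ?_
      rw [uIcc_of_le ht'.1.le] at hs
      have hs' : s ∈ Icc 0 S := ⟨hs.1, hs.2.trans ht'.2⟩
      have f1 : ∀ x, deriv (fun r => φ r x) s = deriv θ s * G x := fun x => by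
        have : (fun r => φ r x) = fun r => (θ r * κ r) * G x := rfl
        rw [this, deriv_mul_const_field, (hκ s hs').deriv_eq]
      have f2 : ∀ x, gradient (φ s) x = θ s • gradient G x := fun x => by
        have : φ s = fun x => θ s * G x := funext (hφs s hs')
        rw [this, gradient, gradient, fderiv_const_mul (hG.differentiable (by simp) x), map_smul]
      simp only [f1, f2, hφs s hs', inner_smul_right]
      have j1 := integrable_mul_of_locallyIntegrable (ht.2.1.1 s (hsub hs')) hG.continuous hGc
      have j2 := integrable_inner_of_locallyIntegrable (hg.1 s (hsub hs')).2.1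
        (contDiff_gradient hG).continuous (hasCompactSupport_gradient hGc)
      have f3 : ∫ x, inner ℝ (Dw s x) (gradient G x) = -(‖ξ‖ ^ 2 * ∫ x, w s x * E x) := by
        rw [(hg.1 s (hsub hs')).integral_inner_gradient hG hGc, ← integral_const_mul]
        congr 1
        refine integral_congr_ae ?_
        filter_upwards [hsupp s hs'] with x hx
        by_cases hxr : ‖x‖ ≤ R + S
        · simp only [laplacian_of_eventuallyEq_exp_inner (hGE x hxr)]
          ring
        · simp [hx (not_le.1 hxr)]
      have f4 : ∀ x, -(w' s x * (deriv θ s * G x)) + θ s * inner ℝ (Dw s x) (gradient G x)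
          + β s * w' s x * (θ s * G x) = (β s * θ s - deriv θ s) * (w' s x * G x)
          + θ s * inner ℝ (Dw s x) (gradient G x) := fun x => by ring
      simp only [f4]
      rw [integral_add (j1.const_mul _) (j2.const_mul _), integral_const_mul, integral_const_mul, f3]
      simp only [hy]
      ring
    rw [e1, e2, e3, e4] at h1
    linarith
  have hprim : ∀ f : ℝ → ℝ, IntervalIntegrable f volume 0 S →
      ContinuousOn (fun t => ∫ s in (0 : ℝ)..t, f s) (Icc 0 S) := fun f hf => by
    rw [← uIcc_of_le hS.le]
    exact (hf.absolutelyContinuousOnInterval_intervalIntegral (c := 0) (by simp)).continuousOn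
  have hu : uIcc 0 S = Icc 0 S := uIcc_of_le hS.le
  -- The weak identity is available only for t > 0. With θ = 1 both sides extend continuously to t =
  -- 0, which identifies y(0) with the moment of the initial velocity.
  have hy0 : y 0 = ∫ x, w₁ x * E x := by
    have i1 : IntervalIntegrable (fun s => -(‖ξ‖ ^ 2 * ∫ x, w s x * E x) + β s * y s) volume 0 S :=
      (ContinuousOn.intervalIntegrable (by rw [hu]; exact (continuousOn_const.mul hHc).neg)).add
        (hβ.mul_continuousOn (hu ▸ hyc))
    have heq : EqOn (fun t => y t + ∫ s in (0 : ℝ)..t,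
        (-(‖ξ‖ ^ 2 * ∫ x, w s x * E x) + β s * y s))
        (fun t => (∫ x, w₁ x * E x) + ∫ s in (0 : ℝ)..t, ∫ x, h s x * E x) (Ioc 0 S) :=
      fun t ht' => by
        have := hpos (fun _ => 1) contDiff_const t ht'
        simpa using this
    have := heq.of_subset_closure (hyc.add (hprim _ i1))
      (continuousOn_const.add (hprim _ hNi)) Ioc_subset_Icc_self
      (by rw [closure_Ioc hS.ne]) (left_mem_Icc.2 hS.le)
    simpa using this
  refine ⟨y, hβ, hNi, hyc, hder, fun θ hθ t ht' => ?_⟩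
  rcases ht'.1.eq_or_lt with h0 | h0
  · subst h0
    simp [hy0]
    exact Or.inl rfl
  · exact hpos θ hθ t ⟨h0, ht'.2⟩

end Nakao

/-! ### Superposition of plane waves over a frequency shell -/

namespace Nakao

variable {n : ℕ}

/-- In an orthonormal basis containing e the integrand is a product of one Gaussian of coefficient 1
and n - 1 of coefficient a. The transverse factors are the source of the decay a^(-(n-1)/2). -/
theorem gaussian_of_unit (hn : 1 ≤ n) {e : Space n} (he : ‖e‖ = 1) {a : ℝ} (ha : 0 < a) :
    Integrable (fun ξ : Space n =>
      Real.exp (-(inner ℝ e ξ) ^ 2 - a * (‖ξ‖ ^ 2 - (inner ℝ e ξ) ^ 2))) ∧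
    ∫ ξ : Space n, Real.exp (-(inner ℝ e ξ) ^ 2 - a * (‖ξ‖ ^ 2 - (inner ℝ e ξ) ^ 2))
      = √Real.pi * √(Real.pi / a) ^ (n - 1) := by
  let i₀ : Fin n := ⟨0, hn⟩
  obtain ⟨b, hb⟩ := Orthonormal.exists_orthonormalBasis_extension_of_card_eq (𝕜 := ℝ)
    (E := Space n) (ι := Fin n) (by simp) (v := fun _ => e) (s := {i₀})
    ⟨fun _ => by simpa using he, fun i j hij => absurd (Subsingleton.elim i j) hij⟩
  have hb0 : b i₀ = e := hb i₀ rfl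
  set c : Fin n → ℝ := fun i => if i = i₀ then 1 else a with hc
  have hcpos : ∀ i, 0 < c i := fun i => by simp only [hc]; split_ifs <;> [norm_num; exact ha]
  have h1 : ∀ z : Fin n → ℝ, Real.exp (-(inner ℝ e (b.repr.symm (WithLp.toLp 2 z))) ^ 2
      - a * (‖b.repr.symm (WithLp.toLp 2 z)‖ ^ 2
        - (inner ℝ e (b.repr.symm (WithLp.toLp 2 z))) ^ 2))
      = ∏ i, Real.exp (-(c i) * (z i) ^ 2) := fun z => by
    rw [← Real.exp_sum]
    congr 1
    have h2 : inner ℝ e (b.repr.symm (WithLp.toLp 2 z)) = z i₀ := by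
      rw [← hb0, ← b.repr_apply_apply]; simp
    have h3 : ‖b.repr.symm (WithLp.toLp 2 z)‖ ^ 2 = ∑ i, (z i) ^ 2 := by
      rw [LinearIsometryEquiv.norm_map, EuclideanSpace.norm_sq_eq]; simp
    rw [h2, h3, ← Finset.add_sum_erase _ _ (Finset.mem_univ i₀),
      ← Finset.add_sum_erase (a := i₀) _ _ (Finset.mem_univ i₀)]
    have h4 : ∑ i ∈ Finset.univ.erase i₀, -(c i) * (z i) ^ 2
        = -a * ∑ i ∈ Finset.univ.erase i₀, (z i) ^ 2 := by
      rw [Finset.mul_sum]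
      refine Finset.sum_congr rfl fun i hi => ?_
      simp [hc, Finset.ne_of_mem_erase hi]
    rw [h4]
    simp [hc]
    ring
  have m1 := b.measurePreserving_repr_symm
  have m2 := PiLp.volume_preserving_toLp (Fin n)
  have emb1 : MeasurableEmbedding (b.repr.symm) :=
    b.repr.symm.toHomeomorph.measurableEmbedding
  have emb2 : MeasurableEmbedding (WithLp.toLp 2 : (Fin n → ℝ) → _) :=
    (MeasurableEquiv.toLp 2 (Fin n → ℝ)).measurableEmbedding
  constructor
  · rw [← m1.integrable_comp_emb emb1, ← m2.integrable_comp_emb emb2]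
    refine (Integrable.fintype_prod (f := fun i z => Real.exp (-(c i) * z ^ 2))
      fun i => integrable_exp_neg_mul_sq (hcpos i)).congr (Eventually.of_forall fun z => ?_)
    exact (h1 z).symm
  · rw [← m1.integral_comp emb1, ← m2.integral_comp emb2]
    simp only [h1]
    rw [integral_fintype_prod_volume_eq_prod (fun i z => Real.exp (-(c i) * z ^ 2))]
    simp only [integral_gaussian]
    rw [← Finset.mul_prod_erase _ _ (Finset.mem_univ i₀)]
    congr 1
    · simp [hc]
    · rw [Finset.prod_congr rfl (g := fun _ => √(Real.pi / a)) fun i hi => by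
        simp [hc, Finset.ne_of_mem_erase hi]]
      rw [Finset.prod_const, Finset.card_erase_of_mem (Finset.mem_univ _), Finset.card_univ,
        Fintype.card_fin]

/-- The frequency shell `1 ≤ |ξ| ≤ 2`. -/
def shell (n : ℕ) : Set (Space n) := {ξ | 1 ≤ ‖ξ‖ ∧ ‖ξ‖ ≤ 2}

theorem measurableSet_shell : MeasurableSet (shell n) :=
  (isClosed_Icc.preimage continuous_norm).measurableSet

theorem isCompact_shell : IsCompact (shell n) :=
  (isCompact_closedBall (0 : Space n) 2).of_isClosed_subset
    (isClosed_Icc.preimage continuous_norm) fun ξ hξ => by simpa using hξ.2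

theorem volume_shell_pos (hn : 1 ≤ n) : 0 < (volume : Measure (Space n)).real (shell n) := by
  refine ENNReal.toReal_pos (ne_of_gt ?_) isCompact_shell.measure_lt_top.ne
  have ho : IsOpen {ξ : Space n | 1 < ‖ξ‖ ∧ ‖ξ‖ < 2} := isOpen_Ioo.preimage continuous_norm
  refine (ho.measure_pos volume ⟨EuclideanSpace.single ⟨0, hn⟩ (3 / 2), ?_⟩).trans_le
    (measure_mono fun ξ hξ => ⟨hξ.1.le, hξ.2.le⟩)
  simp only [mem_ofPred_eq, PiLp.norm_single]
  norm_num

/-- Upper bound for a superposition of plane waves. -/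
theorem integral_shell_le (hn : 1 ≤ n) {R : ℝ} (hR : 0 ≤ R) : ∃ C : ℝ, 0 < C ∧
    ∀ (x : Space n) (t : ℝ), ‖x‖ ≤ R + t →
      ∫ ξ in shell n, Real.exp (inner ℝ x ξ - ‖ξ‖ * t) ≤
        C * (Real.exp (‖x‖ - t) * (1 + ‖x‖) ^ (-(((n : ℝ) - 1) / 2))) := by
  refine ⟨Real.exp (R + 5) * (√Real.pi * √(4 * Real.pi) ^ (n - 1)), by positivity,
    fun x t hx => ?_⟩
  obtain ⟨e, he, hxe⟩ : ∃ e : Space n, ‖e‖ = 1 ∧ x = ‖x‖ • e := by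
    by_cases h0 : x = 0
    · exact ⟨EuclideanSpace.single ⟨0, hn⟩ 1, by simp, by simp [h0]⟩
    · have : ‖x‖ ≠ 0 := norm_ne_zero_iff.2 h0
      exact ⟨‖x‖⁻¹ • x, by rw [norm_smul]; simp [this], by rw [smul_smul]; simp [this]⟩
  set r := ‖x‖ with hr
  have hr0 : 0 ≤ r := norm_nonneg x
  have ha : 0 < (1 + r) / 4 := by positivity
  obtain ⟨gi, ge⟩ := gaussian_of_unit hn he ha
  -- Write ρ = |ξ|, s = e·ξ. The phase is rs - ρt = ρ(r-t) - r(ρ-s). Here ρ(r-t) ≤ r - t + R because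
  -- 0 ≤ ρ-1 ≤ 1 and r - t ≤ R, while ρ-s ≥ (ρ²-s²)/4 because ρ+s ≤ 4. Completing this to the
  -- Gaussian of coefficient (1+r)/4 costs a bounded amount, covered by the 5.
  have hpt : ∀ ξ ∈ shell n, Real.exp (inner ℝ x ξ - ‖ξ‖ * t) ≤ Real.exp (r - t + R + 5) *
      Real.exp (-(inner ℝ e ξ) ^ 2 - (1 + r) / 4 * (‖ξ‖ ^ 2 - (inner ℝ e ξ) ^ 2)) := by
    intro ξ hξ
    rw [← Real.exp_add]
    refine Real.exp_le_exp.2 ?_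
    have h1 : inner ℝ x ξ = r * inner ℝ e ξ := by
      conv_lhs => rw [hxe]
      rw [real_inner_smul_left]
    rw [h1]
    have h2 : |inner ℝ e ξ| ≤ ‖ξ‖ := by
      have := abs_real_inner_le_norm e ξ
      rwa [he, one_mul] at this
    obtain ⟨h3, h4⟩ := hξ
    set s : ℝ := inner ℝ e ξ
    set ρ : ℝ := ‖ξ‖
    obtain ⟨h5, h6⟩ := abs_le.1 h2
    have k1 : (ρ - 1) * (r - t) ≤ R := by nlinarith
    have k2 : 0 ≤ (ρ - s) * (4 - (ρ + s)) := mul_nonneg (by linarith) (by linarith)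
    have k3 : s ^ 2 ≤ ρ ^ 2 := sq_le_sq' h5 h6
    have k4 : ρ ^ 2 ≤ 4 := by nlinarith
    nlinarith [mul_nonneg hr0 k2, sq_nonneg s]
  have hle : ∫ ξ in shell n, Real.exp (inner ℝ x ξ - ‖ξ‖ * t) ≤ Real.exp (r - t + R + 5) *
      (√Real.pi * √(Real.pi / ((1 + r) / 4)) ^ (n - 1)) := by
    rw [← ge, ← integral_const_mul]
    refine (setIntegral_mono_on ?_ (gi.const_mul _).integrableOn measurableSet_shell hpt).trans ?_
    · exact ContinuousOn.integrableOn_compact isCompact_shell (by fun_prop)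
    · exact setIntegral_le_integral (gi.const_mul _)
        (Eventually.of_forall fun ξ => by simp only [Pi.zero_apply]; positivity)
  refine hle.trans (le_of_eq ?_)
  have e1 : √(Real.pi / ((1 + r) / 4)) ^ (n - 1)
      = √(4 * Real.pi) ^ (n - 1) * (1 + r) ^ (-(((n : ℝ) - 1) / 2)) := by
    have : Real.pi / ((1 + r) / 4) = 4 * Real.pi / (1 + r) := by field_simp
    rw [this, Real.sqrt_div (by positivity), div_pow, div_eq_mul_inv]
    congr 1
    rw [Real.rpow_neg (by positivity), Real.sqrt_eq_rpow (1 + r), ← Real.rpow_natCast,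
      ← Real.rpow_mul (by positivity), Nat.cast_sub hn]
    congr 2
    push_cast; ring
  rw [e1, show r - t + R + 5 = (R + 5) + (r - t) by ring, Real.exp_add]
  ring

theorem one_add_rpow_le_exp {m z : ℝ} (hm : 0 ≤ m) (hz : 0 ≤ z) :
    (1 + z) ^ m ≤ (2 * m + 1) ^ m * Real.exp (z / 2) := by
  have hc : 0 < 2 * m + 1 := by linarith
  have h1 : 1 + z ≤ (2 * m + 1) * Real.exp (z / (2 * m + 1)) := by
    have := Real.add_one_le_exp (z / (2 * m + 1))
    have h2 : 1 + z ≤ (2 * m + 1) * (z / (2 * m + 1) + 1) := by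
      field_simp; linarith
    exact h2.trans (by gcongr)
  calc (1 + z) ^ m ≤ ((2 * m + 1) * Real.exp (z / (2 * m + 1))) ^ m :=
        Real.rpow_le_rpow (by linarith) h1 hm
    _ = (2 * m + 1) ^ m * Real.exp (z / (2 * m + 1) * m) := by
        rw [Real.mul_rpow hc.le (Real.exp_pos _).le, ← Real.exp_mul]
    _ ≤ _ := by
        gcongr
        rw [div_mul_eq_mul_div, div_le_div_iff₀ hc (by norm_num)]
        nlinarith

/-- A Peetre-type inequality: it moves a power weight of either sign from r to t at the cost of a
power of the distance |r - t| to the cone. -/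
theorem one_add_rpow_le {r t : ℝ} (hr : 0 ≤ r) (ht : 0 ≤ t) (k : ℝ) :
    (1 + r) ^ k ≤ (1 + t) ^ k * (1 + |r - t|) ^ |k| := by
  have a1 := le_abs_self (r - t)
  have a2 := neg_abs_le (r - t)
  have a3 := abs_nonneg (r - t)
  rcases le_total 0 k with hk | hk
  · rw [abs_of_nonneg hk, ← Real.mul_rpow (by linarith) (by linarith)]
    exact Real.rpow_le_rpow (by linarith) (by nlinarith) hk
  · rw [abs_of_nonpos hk, Real.rpow_neg (by linarith), ← div_eq_mul_inv,
      ← Real.div_rpow (by linarith) (by linarith)]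
    refine Real.rpow_le_rpow_of_nonpos (by positivity) ?_ hk
    rw [div_le_iff₀ (by linarith)]
    nlinarith

/-- The weight concentrates at r = t, so r may be traded for t. The resulting power of 1 + |r-t| is
absorbed by e^(|r-t|/2); since P ≥ 1 and r - t ≤ R, a factor e^((r-t)/2) remains, whose integral
over r ≤ R + t is bounded uniformly in t. -/
theorem radial_pointwise (hn : 1 ≤ n) {R P : ℝ} (hR : 0 ≤ R) (hP : 1 ≤ P) : ∃ C : ℝ, 0 < C ∧
    ∀ r t : ℝ, 0 ≤ r → 0 ≤ t → r ≤ R + t →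
      r ^ (n - 1) * (Real.exp (r - t) * (1 + r) ^ (-(((n : ℝ) - 1) / 2))) ^ P ≤
        C * (1 + t) ^ (((n : ℝ) - 1) * (1 - P / 2)) * Real.exp ((r - t) / 2) := by
  set k : ℝ := ((n : ℝ) - 1) * (1 - P / 2) with hk
  refine ⟨(2 * |k| + 1) ^ |k| * Real.exp (P * R), by positivity, fun r t hr ht hrt => ?_⟩
  have e1 : (Real.exp (r - t) * (1 + r) ^ (-(((n : ℝ) - 1) / 2))) ^ P
      = Real.exp (P * (r - t)) * (1 + r) ^ (-(((n : ℝ) - 1) / 2) * P) := by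
    rw [Real.mul_rpow (Real.exp_pos _).le (by positivity), ← Real.exp_mul, mul_comm P,
      ← Real.rpow_mul (by positivity)]
  have e2 : r ^ (n - 1) ≤ (1 + r) ^ ((n : ℝ) - 1) := by
    have : ((n : ℝ) - 1) = ((n - 1 : ℕ) : ℝ) := by rw [Nat.cast_sub hn]; simp
    rw [this, Real.rpow_natCast]
    gcongr; linarith
  have e3 : (1 + r) ^ ((n : ℝ) - 1) * (1 + r) ^ (-(((n : ℝ) - 1) / 2) * P) = (1 + r) ^ k := by
    rw [← Real.rpow_add (by positivity)]; congr 1; rw [hk]; ring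
  have e4 := one_add_rpow_le hr ht k
  have e5 := one_add_rpow_le_exp (abs_nonneg k) (abs_nonneg (r - t))
  have e6 : Real.exp (|r - t| / 2) * Real.exp (P * (r - t)) ≤
      Real.exp (P * R) * Real.exp ((r - t) / 2) := by
    rw [← Real.exp_add, ← Real.exp_add]
    refine Real.exp_le_exp.2 ?_
    have : 0 ≤ P * R := by positivity
    rcases le_total r t with h | h
    · rw [abs_of_nonpos (by linarith)]
      nlinarith
    · rw [abs_of_nonneg (by linarith)]
      nlinarith
  rw [e1]
  calc r ^ (n - 1) * (Real.exp (P * (r - t)) * (1 + r) ^ (-(((n : ℝ) - 1) / 2) * P))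
      ≤ (1 + r) ^ ((n : ℝ) - 1) *
        (Real.exp (P * (r - t)) * (1 + r) ^ (-(((n : ℝ) - 1) / 2) * P)) := by gcongr
    _ = (1 + r) ^ k * Real.exp (P * (r - t)) := by rw [← e3]; ring
    _ ≤ ((1 + t) ^ k * ((2 * |k| + 1) ^ |k| * Real.exp (|r - t| / 2))) *
        Real.exp (P * (r - t)) := by
        gcongr
        exact e4.trans (by gcongr)
    _ = (1 + t) ^ k * (2 * |k| + 1) ^ |k| *
        (Real.exp (|r - t| / 2) * Real.exp (P * (r - t))) := by ring
    _ ≤ (1 + t) ^ k * (2 * |k| + 1) ^ |k| *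
        (Real.exp (P * R) * Real.exp ((r - t) / 2)) := by gcongr
    _ = _ := by ring

theorem integral_radial_le (hn : 1 ≤ n) {R P : ℝ} (hR : 0 ≤ R) (hP : 1 ≤ P) :
    ∃ C : ℝ, 0 < C ∧ ∀ t : ℝ, 0 ≤ t →
      ∫ x in Metric.closedBall (0 : Space n) (R + t),
        (Real.exp (‖x‖ - t) * (1 + ‖x‖) ^ (-(((n : ℝ) - 1) / 2))) ^ P ≤
        C * (1 + t) ^ (((n : ℝ) - 1) * (1 - P / 2)) := by
  obtain ⟨C, hC, hpt⟩ := radial_pointwise hn hR hP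
  have : Nontrivial (Space n) := by
    have : Nonempty (Fin n) := ⟨⟨0, hn⟩⟩
    infer_instance
  set V : ℝ := (volume : Measure (Space n)).real (Metric.ball 0 1) with hV
  have hV0 : 0 ≤ V := measureReal_nonneg
  refine ⟨(n * V + 1) * (C * (2 * Real.exp (R / 2))), by positivity, fun t ht => ?_⟩
  set F : ℝ → ℝ := fun r => (Real.exp (r - t) * (1 + r) ^ (-(((n : ℝ) - 1) / 2))) ^ P with hF
  have h1 : ∫ x in Metric.closedBall (0 : Space n) (R + t), F ‖x‖
      = ∫ x : Space n, (Iic (R + t)).indicator F ‖x‖ := by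
    rw [← integral_indicator Metric.isClosed_closedBall.measurableSet]
    congr 1; ext x
    simp [indicator]
  have h2 : ∫ r in Ioi (0 : ℝ), r ^ (n - 1) • (Iic (R + t)).indicator F r
      ≤ C * (1 + t) ^ (((n : ℝ) - 1) * (1 - P / 2)) * (2 * Real.exp (R / 2)) := by
    have e1 : ∀ r, r ^ (n - 1) • (Iic (R + t)).indicator F r
        = (Iic (R + t)).indicator (fun r => r ^ (n - 1) * F r) r := fun r => by
      simp [indicator]
    simp only [e1]
    rw [setIntegral_indicator measurableSet_Iic, Ioi_inter_Iic]
    have hc : ContinuousOn (fun r => C * (1 + t) ^ (((n : ℝ) - 1) * (1 - P / 2)) *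
      Real.exp ((r - t) / 2)) (Icc 0 (R + t)) := by fun_prop
    have hi : ContinuousOn (fun r => r ^ (n - 1) * F r) (Icc 0 (R + t)) := by
      refine ContinuousOn.mul (by fun_prop) ?_
      refine ContinuousOn.rpow_const ?_ fun r _ => Or.inr (by linarith)
      refine ContinuousOn.mul (by fun_prop) (ContinuousOn.rpow_const (by fun_prop) fun r hr => ?_)
      left; have := hr.1; positivity
    refine (setIntegral_mono_on (hi.integrableOn_Icc.mono_set Ioc_subset_Icc_self)
      (hc.integrableOn_Icc.mono_set Ioc_subset_Icc_self) measurableSet_Ioc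
      fun r hr => hpt r t hr.1.le ht hr.2).trans ?_
    rw [integral_const_mul]
    gcongr
    rw [← intervalIntegral.integral_of_le (by linarith)]
    have hd : ∀ r, HasDerivAt (fun r => 2 * Real.exp ((r - t) / 2)) (Real.exp ((r - t) / 2)) r :=
      fun r => by
        have := ((((hasDerivAt_id r).sub_const t).div_const 2).exp).const_mul 2
        convert! this using 1
        simp
        ring
    rw [intervalIntegral.integral_eq_sub_of_hasDerivAt (fun r _ => hd r)
      (Continuous.intervalIntegrable (by fun_prop) _ _)]
    have : 0 < Real.exp ((0 - t) / 2) := Real.exp_pos _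
    rw [show R + t - t = R by ring]
    linarith
  change ∫ x in Metric.closedBall (0 : Space n) (R + t), F ‖x‖ ≤ _
  rw [h1, integral_fun_norm_addHaar volume (fun r => (Iic (R + t)).indicator F r)]
  rw [finrank_euclideanSpace_fin, nsmul_eq_mul, smul_eq_mul]
  have hB : 0 ≤ C * (1 + t) ^ (((n : ℝ) - 1) * (1 - P / 2)) * (2 * Real.exp (R / 2)) := by
    positivity
  calc (n : ℝ) * (V * ∫ r in Ioi (0 : ℝ), r ^ (n - 1) • (Iic (R + t)).indicator F r)
      ≤ n * (V * (C * (1 + t) ^ (((n : ℝ) - 1) * (1 - P / 2)) * (2 * Real.exp (R / 2)))) := by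
        gcongr
    _ ≤ (n * V + 1) * (C * (1 + t) ^ (((n : ℝ) - 1) * (1 - P / 2)) * (2 * Real.exp (R / 2))) := by
        nlinarith
    _ = _ := by ring

end Nakao

/-! ### Lower bound for the p-th power integral from exponential moments -/

namespace Nakao

variable {n : ℕ} {p P ρ : ℝ} {f g : Space n → ℝ}

theorem integrable_mul_of_suppInBall (hf : LocallyIntegrable f) (hs : SuppInBall ρ f)
    (hg : Continuous g) : Integrable (fun x => f x * g x) := by
  have h1 : IntegrableOn (fun x => f x * g x) (Metric.closedBall 0 ρ) :=
    (hf.integrableOn_isCompact (isCompact_closedBall _ _)).mul_continuousOn hg.continuousOn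
      (isCompact_closedBall _ _)
  refine h1.integrable_of_ae_notMem_eq_zero ?_
  filter_upwards [hs] with x hx hx'
  rw [hx (by simpa using hx'), zero_mul]

theorem integral_abs_mul_le (hpP : p.HolderConjugate P) (hf : LocallyIntegrable f)
    (hs : SuppInBall ρ f) (hfp : Integrable (fun x => |f x| ^ p)) (hg : Continuous g)
    (hg0 : ∀ x, 0 ≤ g x) :
    ∫ x, |f x| * g x ≤ (∫ x, |f x| ^ p) ^ (1 / p) *
      (∫ x in Metric.closedBall 0 ρ, g x ^ P) ^ (1 / P) := by
  have hp := hpP.pos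
  have hP := hpP.symm.pos
  set B : Set (Space n) := Metric.closedBall 0 ρ with hB
  have hBm : MeasurableSet B := Metric.isClosed_closedBall.measurableSet
  have e1 : ∫ x, |f x| * g x = ∫ x, |f x| * B.indicator g x := by
    refine integral_congr_ae ?_
    filter_upwards [hs] with x hx
    by_cases hxB : x ∈ B
    · simp [hxB]
    · simp [hx (by simpa [hB] using hxB)]
  have e2 : ∫ x in B, g x ^ P = ∫ x, (B.indicator g x) ^ P := by
    rw [← integral_indicator hBm]
    congr 1; ext x
    by_cases hxB : x ∈ B
    · simp [hxB]
    · simp [hxB, Real.zero_rpow hP.ne']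
  rw [e1, e2]
  refine integral_mul_le_Lp_mul_Lq_of_nonneg hpP (Eventually.of_forall fun x => abs_nonneg _)
    (Eventually.of_forall fun x => indicator_nonneg (fun x _ => hg0 x) x) ?_ ?_
  · have h1 : Integrable (fun x => ‖f x‖ ^ (ENNReal.ofReal p).toReal) := by
      simpa [ENNReal.toReal_ofReal hp.le] using hfp
    exact ((integrable_norm_rpow_iff hf.aestronglyMeasurable (by simpa using hp) (by simp)).1
      h1).norm
  · rw [memLp_indicator_iff_restrict hBm]
    have hBc : IsCompact B := isCompact_closedBall _ _
    have : IsFiniteMeasure (volume.restrict B) := ⟨by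
      rw [Measure.restrict_apply_univ]; exact hBc.measure_lt_top⟩
    obtain ⟨C, hC⟩ := hBc.exists_bound_of_continuousOn hg.continuousOn
    exact MemLp.of_bound hg.aestronglyMeasurable C (ae_restrict_of_forall_mem hBm hC)

theorem abs_integral_rpow_le (hpP : p.HolderConjugate P) (hf : LocallyIntegrable f)
    (hs : SuppInBall ρ f) (hfp : Integrable (fun x => |f x| ^ p)) (hρ : 0 ≤ ρ) :
    |∫ x, f x| ≤ (∫ x, |f x| ^ p) ^ (1 / p) *
      ((volume : Measure (Space n)).real (Metric.ball 0 1) * ρ ^ n) ^ (1 / P) := by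
  have h := integral_abs_mul_le hpP hf hs hfp (g := fun _ => 1) continuous_const (by simp)
  simp only [mul_one, Real.one_rpow, integral_const, smul_eq_mul, measureReal_restrict_apply_univ]
    at h
  rw [Measure.addHaar_real_closedBall _ _ hρ, finrank_euclideanSpace_fin, mul_comm (ρ ^ n)] at h
  exact (abs_integral_le_integral_abs).trans h

theorem continuous_weight (t k : ℝ) :
    Continuous (fun x : Space n => Real.exp (‖x‖ - t) * (1 + ‖x‖) ^ k) := by
  refine Continuous.mul (by fun_prop) (Continuous.rpow_const (by fun_prop) fun x => Or.inl ?_)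
  positivity

/-- Lower bound for the `L^p` norm of a function all of whose exponential moments with frequency
in the shell grow like free waves. -/
theorem integral_rpow_ge_of_moments (hn : 1 ≤ n) {R : ℝ} (hR : 0 ≤ R) (hp : 1 < p) :
    ∃ c : ℝ, 0 < c ∧ ∀ (t : ℝ) (f : Space n → ℝ) (δ : ℝ), 0 ≤ t → 0 ≤ δ → LocallyIntegrable f →
      SuppInBall (R + t) f → Integrable (fun x => |f x| ^ p) →
      (∀ ξ ∈ shell n, δ * Real.exp (‖ξ‖ * t) ≤ ∫ x, f x * Real.exp (inner ℝ x ξ)) →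
      c * δ ^ p * (1 + t) ^ (((n : ℝ) - 1) * (1 - p / 2)) ≤ ∫ x, |f x| ^ p := by
  set P := p.conjExponent with hPdef
  have hpP : p.HolderConjugate P := Real.HolderConjugate.conjExponent hp
  obtain ⟨C₁, hC₁, h₁⟩ := integral_shell_le hn hR
  obtain ⟨C₂, hC₂, h₂⟩ := integral_radial_le hn hR hpP.symm.lt.le
  set M := (volume : Measure (Space n)).real (shell n) with hM
  have hM0 : 0 < M := volume_shell_pos hn
  refine ⟨(M / C₁ / C₂ ^ (1 / P)) ^ p, by positivity, fun t f δ ht hδ hf hs hfp hmom => ?_⟩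
  set w : Space n → ℝ := fun x => Real.exp (‖x‖ - t) * (1 + ‖x‖) ^ (-(((n : ℝ) - 1) / 2)) with hw
  have hwc : Continuous w := continuous_weight _ _
  have hw0 : ∀ x, 0 ≤ w x := fun x => by simp only [hw]; positivity
  have hfa : LocallyIntegrable (fun x => |f x|) := fun x => by
    obtain ⟨s, hs, hi⟩ := hf x
    exact ⟨s, hs, hi.abs⟩
  have hsa : SuppInBall (R + t) (fun x => |f x|) := by
    filter_upwards [hs] with x hx hx'
    rw [hx hx', abs_zero]
  have hfi : Integrable (fun x => |f x|) := by
    simpa using integrable_mul_of_suppInBall hfa hsa (g := fun _ => 1) continuous_const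
  set μ := (volume : Measure (Space n)).restrict (shell n) with hμ
  have : IsFiniteMeasure μ := ⟨by
    rw [hμ, Measure.restrict_apply_univ]; exact isCompact_shell.measure_lt_top⟩
  -- Needed for Fubini: on the support of f and for ξ in the shell, the kernel is at most
  -- e^(2(R+t)).
  have hF : Integrable (fun z : Space n × Space n =>
      |f z.2| * Real.exp (inner ℝ z.2 z.1 - ‖z.1‖ * t)) (μ.prod volume) := by
    have k1 : Integrable (fun z : Space n × Space n => |f z.2|) (μ.prod volume) := hfi.comp_snd μ
    refine (k1.mul_const (Real.exp ((R + t) * 2))).mono' (k1.aestronglyMeasurable.mul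
      (Continuous.aestronglyMeasurable (by fun_prop))) ?_
    have a1 : ∀ᵐ z : Space n × Space n ∂(μ.prod volume), z.1 ∈ shell n :=
      Measure.quasiMeasurePreserving_fst.ae (ae_restrict_mem measurableSet_shell)
    have a2 : ∀ᵐ z : Space n × Space n ∂(μ.prod volume), R + t < ‖z.2‖ → f z.2 = 0 :=
      Measure.quasiMeasurePreserving_snd.ae hs
    filter_upwards [a1, a2] with z hz1 hz2
    rw [norm_mul, Real.norm_eq_abs, abs_abs, Real.norm_eq_abs, Real.abs_exp]
    by_cases hz : R + t < ‖z.2‖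
    · simp [hz2 hz]
    · push Not at hz
      gcongr
      have b1 := real_inner_le_norm z.2 z.1
      have b2 : ‖z.2‖ * ‖z.1‖ ≤ (R + t) * 2 := by
        gcongr
        exact hz1.2
      have b3 : 0 ≤ ‖z.1‖ * t := by positivity
      linarith
  have hΨ : Integrable (fun x => ∫ ξ in shell n, |f x| * Real.exp (inner ℝ x ξ - ‖ξ‖ * t)) :=
    hF.integral_prod_right
  have hΦ : Integrable (fun ξ => ∫ x, |f x| * Real.exp (inner ℝ x ξ - ‖ξ‖ * t)) μ :=
    hF.integral_prod_left
  have s1 : δ * M ≤ ∫ ξ in shell n, ∫ x, |f x| * Real.exp (inner ℝ x ξ - ‖ξ‖ * t) := by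
    have : δ * M = ∫ ξ in shell n, δ := by simp [hM, mul_comm]
    rw [this]
    refine setIntegral_mono_on (integrableOn_const isCompact_shell.measure_lt_top.ne) hΦ
      measurableSet_shell fun ξ hξ => ?_
    have e1 : ∫ x, |f x| * Real.exp (inner ℝ x ξ - ‖ξ‖ * t)
        = Real.exp (-(‖ξ‖ * t)) * ∫ x, |f x| * Real.exp (inner ℝ x ξ) := by
      rw [← integral_const_mul]
      congr 1; ext x; rw [sub_eq_add_neg, Real.exp_add]; ring
    have hce : Continuous (fun x : Space n => Real.exp (inner ℝ x ξ)) := by fun_prop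
    have e2 : δ * Real.exp (‖ξ‖ * t) ≤ ∫ x, |f x| * Real.exp (inner ℝ x ξ) := by
      refine (hmom ξ hξ).trans (integral_mono (integrable_mul_of_suppInBall hf hs hce)
        (integrable_mul_of_suppInBall hfa hsa hce) fun x => ?_)
      exact mul_le_mul_of_nonneg_right (le_abs_self _) (Real.exp_pos _).le
    rw [e1]
    calc δ = Real.exp (-(‖ξ‖ * t)) * (δ * Real.exp (‖ξ‖ * t)) := by
          rw [mul_left_comm, ← Real.exp_add]; simp
      _ ≤ _ := by gcongr
  have s2 : ∫ ξ in shell n, ∫ x, |f x| * Real.exp (inner ℝ x ξ - ‖ξ‖ * t)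
      ≤ C₁ * ∫ x, |f x| * w x := by
    rw [integral_integral_swap (f := fun ξ x => |f x| * Real.exp (inner ℝ x ξ - ‖ξ‖ * t)) hF,
      ← integral_const_mul]
    refine integral_mono_ae hΨ ((integrable_mul_of_suppInBall hfa hsa hwc).const_mul _) ?_
    filter_upwards [hs] with x hx
    by_cases hxr : R + t < ‖x‖
    · simp [hx hxr]
    · rw [integral_const_mul]
      have := h₁ x t (not_lt.1 hxr)
      calc |f x| * ∫ ξ in shell n, Real.exp (inner ℝ x ξ - ‖ξ‖ * t)
          ≤ |f x| * (C₁ * w x) := by gcongr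
        _ = _ := by ring
  have s3 := integral_abs_mul_le hpP hf hs hfp hwc hw0
  have s4 := h₂ t ht
  set κ := ((n : ℝ) - 1) * (1 - P / 2) with hκ
  set I := ∫ x, |f x| ^ p with hI
  have hI0 : 0 ≤ I := integral_nonneg fun x => Real.rpow_nonneg (abs_nonneg _) _
  have hp0 := hpP.pos
  have hP0 := hpP.symm.pos
  have s5 : (∫ x in Metric.closedBall 0 (R + t), w x ^ P) ^ (1 / P) ≤
      C₂ ^ (1 / P) * (1 + t) ^ (κ / P) := by
    refine (Real.rpow_le_rpow (integral_nonneg fun x => Real.rpow_nonneg (hw0 x) _) s4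
      (by positivity)).trans (le_of_eq ?_)
    rw [Real.mul_rpow hC₂.le (by positivity), ← Real.rpow_mul (by positivity), mul_one_div]
  have s6 : M / C₁ / C₂ ^ (1 / P) * δ * (1 + t) ^ (-(κ / P)) ≤ I ^ (1 / p) := by
    have : δ * M ≤ C₁ * (I ^ (1 / p) * (C₂ ^ (1 / P) * (1 + t) ^ (κ / P))) := by
      refine s1.trans (s2.trans ?_)
      gcongr
      exact s3.trans (by gcongr)
    have hA : 0 < C₂ ^ (1 / P) := by positivity
    have hB : 0 < (1 + t) ^ (κ / P) := by positivity
    rw [Real.rpow_neg (by positivity), ← div_eq_mul_inv, div_le_iff₀ hB, div_div,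
      div_mul_eq_mul_div, div_le_iff₀ (by positivity)]
    linarith
  have s7 := Real.rpow_le_rpow (by positivity) s6 hp0.le
  rw [← Real.rpow_mul hI0, one_div_mul_cancel hp0.ne', Real.rpow_one,
    Real.mul_rpow (by positivity) (by positivity), Real.mul_rpow (by positivity) hδ,
    ← Real.rpow_mul (by positivity)] at s7
  -- Conjugacy gives p/P = p - 1 and P(p-1) = p, so -κ(p-1) = -(n-1)(p - 1 - p/2).
  have e : -(κ / P) * p = ((n : ℝ) - 1) * (1 - p / 2) := by
    have hc : p / P = p - 1 := by
      rw [hPdef, Real.conjExponent]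
      have : p - 1 ≠ 0 := by linarith
      field_simp
    have hc2 : p = P * (p - 1) := by rw [← hc]; field_simp
    have : -(κ / P) * p = -κ * (p / P) := by ring
    rw [this, hc, hκ]
    linear_combination ((n : ℝ) - 1) / 2 * (-hc2)
  rwa [e] at s7

end Nakao

/-! ### Hölder in space-time and the algebra of exponents -/

namespace Nakao

variable {n : ℕ}

/-- Hölder in time. The condition j + 2 ≤ jr yields θ^j ≤ (θ^(j+2))^(1/r) for θ = 1 - t/S in [0,1],
so the two derivatives lost on the test function are regained and the estimates close on the same
weighted integrals. -/
theorem integral_weight_le {H N : ℝ → ℝ} {S W r P : ℝ} (hrP : r.HolderConjugate P) (hS : 0 < S)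
    (hH : ContinuousOn H (Icc 0 S)) (hNi : IntervalIntegrable N volume 0 S) (hN : ∀ t, 0 ≤ N t)
    (hW : 0 ≤ W) (hle : ∀ᵐ t, t ∈ Ioc 0 S → |H t| ≤ N t ^ (1 / r) * W) {j : ℕ}
    (hj : (j + 2 : ℝ) ≤ j * r) :
    ∫ t in (0 : ℝ)..S, |H t| * (1 - t / S) ^ j ≤
      W * S ^ (1 / P) * (∫ t in (0 : ℝ)..S, (1 - t / S) ^ (j + 2) * N t) ^ (1 / r) := by
  have hr := hrP.pos
  have hP := hrP.symm.pos
  set θ : ℝ → ℝ := fun t => 1 - t / S with hθ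
  have hθ01 : ∀ t ∈ Ioc 0 S, 0 ≤ θ t ∧ θ t ≤ 1 := fun t ht => by
    have h1 : t / S ≤ 1 := (div_le_one hS).2 ht.2
    have h2 : 0 ≤ t / S := div_nonneg ht.1.le hS.le
    exact ⟨by simp only [hθ]; linarith, by simp only [hθ]; linarith⟩
  set μ : Measure ℝ := volume.restrict (Ioc 0 S) with hμ
  have : IsFiniteMeasure μ := ⟨by rw [hμ, Measure.restrict_apply_univ]; simp⟩
  set F : ℝ → ℝ := fun t => θ t ^ (j + 2) * N t with hF
  have hFi : Integrable F μ := by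
    have : IntervalIntegrable F volume 0 S := hNi.continuousOn_mul (by fun_prop)
    rwa [intervalIntegrable_iff_integrableOn_Ioc_of_le hS.le] at this
  have hF0 : ∀ t ∈ Ioc 0 S, 0 ≤ F t := fun t ht =>
    mul_nonneg (pow_nonneg (hθ01 t ht).1 _) (hN t)
  have hFae : 0 ≤ᵐ[μ] F := ae_restrict_of_forall_mem measurableSet_Ioc hF0
  have hFr : MemLp (fun t => F t ^ (1 / r)) (ENNReal.ofReal r) μ := by
    rw [← integrable_norm_rpow_iff
      (hFi.aestronglyMeasurable.aemeasurable.pow_const _).aestronglyMeasurable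
      (by simpa using hr) (by simp), ENNReal.toReal_ofReal hr.le]
    refine hFi.congr ?_
    filter_upwards [hFae] with t ht
    rw [Real.norm_of_nonneg (Real.rpow_nonneg ht _), ← Real.rpow_mul ht,
      one_div_mul_cancel hr.ne', Real.rpow_one]
  have h1 := integral_mul_le_Lp_mul_Lq_of_nonneg hrP (μ := μ) (f := fun t => F t ^ (1 / r))
    (g := fun _ => 1) (by filter_upwards [hFae] with t ht using Real.rpow_nonneg ht _)
    (Eventually.of_forall fun _ => zero_le_one) hFr (memLp_const _)
  have h2 : ∫ t, (F t ^ (1 / r)) ^ r ∂μ = ∫ t, F t ∂μ := by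
    refine integral_congr_ae ?_
    filter_upwards [hFae] with t ht
    rw [← Real.rpow_mul ht, one_div_mul_cancel hr.ne', Real.rpow_one]
  have h3 : ∫ _, (1 : ℝ) ^ P ∂μ = S := by
    simp [hμ, hS.le]
  rw [h2, h3] at h1
  simp only [mul_one] at h1
  have hFri : Integrable (fun t => F t ^ (1 / r)) μ := by
    refine hFr.integrable ?_
    rw [ENNReal.one_le_ofReal]
    exact hrP.lt.le
  rw [intervalIntegral.integral_of_le hS.le, intervalIntegral.integral_of_le hS.le]
  have hcont : ContinuousOn (fun t => |H t| * θ t ^ j) (Icc 0 S) := by fun_prop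
  have h4 : ∫ t, |H t| * θ t ^ j ∂μ ≤ ∫ t, W * F t ^ (1 / r) ∂μ := by
    refine integral_mono_ae (hcont.integrableOn_Icc.mono_set Ioc_subset_Icc_self)
      (hFri.const_mul W) ?_
    rw [EventuallyLE, hμ, ae_restrict_iff' measurableSet_Ioc]
    filter_upwards [hle] with t ht hts
    obtain ⟨k0, k1⟩ := hθ01 t hts
    have k2 : θ t ^ j ≤ (θ t ^ (j + 2)) ^ (1 / r) := by
      rcases k0.eq_or_lt with hz | hz
      · rw [← hz]
        have hj0 : j ≠ 0 := by
          rintro rfl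
          norm_num at hj
        rw [zero_pow hj0]
        positivity
      · rw [← Real.rpow_natCast, ← Real.rpow_natCast, ← Real.rpow_mul k0]
        refine Real.rpow_le_rpow_of_exponent_ge hz k1 ?_
        rw [mul_one_div, div_le_iff₀ hr]
        push_cast
        exact hj
    have k3 : F t ^ (1 / r) = (θ t ^ (j + 2)) ^ (1 / r) * N t ^ (1 / r) :=
      Real.mul_rpow (pow_nonneg k0 _) (hN t)
    rw [k3]
    have k4 : 0 ≤ N t ^ (1 / r) := Real.rpow_nonneg (hN t) _
    calc |H t| * θ t ^ j ≤ (N t ^ (1 / r) * W) * (θ t ^ (j + 2)) ^ (1 / r) :=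
          mul_le_mul (ht hts) k2 (pow_nonneg k0 _) (by positivity)
      _ = _ := by ring
  refine h4.trans ?_
  rw [integral_const_mul]
  calc W * ∫ t, F t ^ (1 / r) ∂μ ≤ W * ((∫ t, F t ∂μ) ^ (1 / r) * S ^ (1 / P)) := by gcongr
    _ = _ := by ring

section Component

variable {T : EReal} {S R r : ℝ} {w : ℝ → Space n → ℝ}

theorem SuppInBall.mono {ρ ρ' : ℝ} {f : Space n → ℝ} (hf : SuppInBall ρ f) (h : ρ ≤ ρ') :
    SuppInBall ρ' f := by
  filter_upwards [hf] with x hx hx' using hx (h.trans_lt hx')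

theorem SuppInBall.abs_rpow {ρ : ℝ} {f : Space n → ℝ} (hf : SuppInBall ρ f) (hr : 0 < r) :
    SuppInBall ρ (fun x => |f x| ^ r) := by
  filter_upwards [hf] with x hx hx'
  rw [hx hx', abs_zero, Real.zero_rpow hr.ne']

theorem MemLrloc.integrableOn (hw : MemLrloc T r w) (hr : 0 < r) (hST : (S : EReal) < T)
    (ρ : ℝ) : IntegrableOn (fun z : ℝ × Space n => |w z.1 z.2| ^ r)
      (Icc 0 S ×ˢ Metric.closedBall 0 ρ) := by
  have h1 := hw (Icc 0 S ×ˢ Metric.closedBall 0 ρ) (isCompact_Icc.prod (isCompact_closedBall _ _))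
    (prod_mono (Icc_subset_times hST) (subset_univ _))
  have h2 := h1.integrable_norm_rpow (by simpa using hr) (by simp)
  simpa [ENNReal.toReal_ofReal hr.le, IntegrableOn] using h2

theorem ae_integrable_abs_rpow (hr : 0 < r)
    (hi : IntegrableOn (fun z : ℝ × Space n => |w z.1 z.2| ^ r)
      (Icc 0 S ×ˢ Metric.closedBall 0 (R + S)))
    (hsupp : ∀ t ∈ Icc 0 S, SuppInBall (R + S) (w t)) :
    ∀ᵐ t, t ∈ Ioc 0 S → Integrable (fun x => |w t x| ^ r) := by
  rw [IntegrableOn, Measure.volume_eq_prod, ← Measure.prod_restrict] at hi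
  have h1 := hi.prod_right_ae
  rw [ae_restrict_iff' measurableSet_Icc] at h1
  filter_upwards [h1] with t ht hts
  refine IntegrableOn.integrable_of_ae_notMem_eq_zero (ht (Ioc_subset_Icc_self hts)) ?_
  filter_upwards [(hsupp t (Ioc_subset_Icc_self hts)).abs_rpow hr] with x hx hx'
  exact hx (by simpa using hx')

/-- Hölder's inequality in space and time for a function supported in a light cone. -/
theorem integral_abs_mean_le (hr : 1 < r) (hR : 0 ≤ R) (hS : 1 ≤ S)
    (hloc : ∀ t ∈ Icc 0 S, LocallyIntegrable (w t))
    (hi : ∀ᵐ t, t ∈ Ioc 0 S → Integrable (fun x => |w t x| ^ r))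
    (hsupp : ∀ t ∈ Icc 0 S, SuppInBall (R + S) (w t))
    (hcont : ContinuousOn (fun t => ∫ x, w t x) (Icc 0 S))
    (hNi : IntervalIntegrable (fun t => ∫ x, |w t x| ^ r) volume 0 S)
    {j : ℕ} (hj : (j + 2 : ℝ) ≤ j * r) :
    ∫ t in (0 : ℝ)..S, |∫ x, w t x| * (1 - t / S) ^ j ≤
      ((volume : Measure (Space n)).real (Metric.ball 0 1) * (R + 1) ^ n) ^ (1 - 1 / r) *
        S ^ (((n : ℝ) + 1) * (1 - 1 / r)) *
        (∫ t in (0 : ℝ)..S, (1 - t / S) ^ (j + 2) * ∫ x, |w t x| ^ r) ^ (1 / r) := by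
  have hrP : r.HolderConjugate r.conjExponent := Real.HolderConjugate.conjExponent hr
  set P := r.conjExponent
  have hS0 : 0 < S := by linarith
  have hP : 1 / P = 1 - 1 / r := by
    have := hrP.inv_add_inv_eq_one
    rw [one_div, one_div]; linarith
  set V := (volume : Measure (Space n)).real (Metric.ball 0 1) with hV
  have hV0 : 0 ≤ V := measureReal_nonneg
  have hN0 : ∀ t, 0 ≤ ∫ x, |w t x| ^ r := fun t =>
    integral_nonneg fun x => Real.rpow_nonneg (abs_nonneg _) _
  have h1 := integral_weight_le (H := fun t => ∫ x, w t x) (N := fun t => ∫ x, |w t x| ^ r)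
    (W := (V * (R + S) ^ n) ^ (1 / P)) hrP hS0 hcont hNi hN0
    (by positivity) (by
      filter_upwards [hi] with t ht hts
      have hts' := Ioc_subset_Icc_self hts
      exact abs_integral_rpow_le hrP (hloc t hts') (hsupp t hts') (ht hts) (by positivity)) hj
  refine h1.trans ?_
  have hI : 0 ≤ ∫ t in (0 : ℝ)..S, (1 - t / S) ^ (j + 2) * ∫ x, |w t x| ^ r := by
    refine intervalIntegral.integral_nonneg hS0.le fun t ht => mul_nonneg (pow_nonneg ?_ _) (hN0 t)
    have : t / S ≤ 1 := (div_le_one hS0).2 ht.2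
    linarith
  refine mul_le_mul_of_nonneg_right ?_ (Real.rpow_nonneg hI _)
  have h2 : V * (R + S) ^ n ≤ V * (R + 1) ^ n * S ^ n := by
    rw [mul_assoc, ← mul_pow]
    gcongr
    nlinarith
  have hP0 := hrP.symm.pos
  calc (V * (R + S) ^ n) ^ (1 / P) * S ^ (1 / P)
      ≤ (V * (R + 1) ^ n * S ^ n) ^ (1 / P) * S ^ (1 / P) := by gcongr
    _ = _ := by
      rw [Real.mul_rpow (by positivity) (by positivity), ← Real.rpow_natCast S n,
        ← Real.rpow_mul hS0.le, mul_assoc, ← Real.rpow_add hS0, hP]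
      congr 2
      ring

end Component

/-- The linear algebra of exponents behind the lifespan estimate. -/
theorem exponent_algebra (n : ℕ) {p q : ℝ} (hp : 1 < p) (hq : 1 < q) (k l₁ l₂ : ℝ) :
    ∃ D : ℝ, ∀ τ e a b : ℝ, 0 ≤ τ →
      q * a ≤ k + (-2 + ((n : ℝ) + 1) * (1 - 1 / p)) * τ + b →
      l₁ + e ≤ k + (-2 + ((n : ℝ) + 1) * (1 - 1 / p)) * τ + b →
      p * b ≤ k + (-1 + ((n : ℝ) + 1) * (1 - 1 / q)) * τ + a →
      l₁ + e ≤ k + (-1 + ((n : ℝ) + 1) * (1 - 1 / q)) * τ + a →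
      l₂ + p * e + (1 + ((n : ℝ) - 1) * (1 - p / 2)) * τ ≤ p * b →
      Gam n p q 0 * τ ≤ D - e := by
  have hp0 : 0 < p := by linarith
  have hq0 : 0 < q := by linarith
  set m := p * q - 1 with hm
  have hm0 : 0 < m := by nlinarith
  refine ⟨max (max (-l₂ / p + (q + 1) * k / m) (k - l₁ + (q + 1) * k / m))
    (k - l₁ + (p + 1) * k / m), fun τ e a b hτ i1 i2 i3 i4 i5 => ?_⟩
  obtain ⟨α, hα⟩ : ∃ α, α = -2 + ((n : ℝ) + 1) * (1 - 1 / p) := ⟨_, rfl⟩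
  obtain ⟨β, hβ⟩ : ∃ β, β = -1 + ((n : ℝ) + 1) * (1 - 1 / q) := ⟨_, rfl⟩
  obtain ⟨σ, hσ⟩ : ∃ σ, σ = 1 + ((n : ℝ) - 1) * (1 - p / 2) := ⟨_, rfl⟩
  rw [← hα] at i1 i2
  rw [← hβ] at i3 i4
  rw [← hσ] at i5
  -- Here τ = log S, e = log ε, a = (log A)/q and b = (log B)/p. Inserting each loop inequality into
  -- the other leaves the factor pq - 1 > 0 on a and on b.
  have ia : a ≤ ((p + 1) * k + (p * α + β) * τ) / m := by
    rw [le_div_iff₀ hm0]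
    have := mul_le_mul_of_nonneg_left i1 hp0.le
    rw [hm]
    linarith
  have ib : b ≤ ((q + 1) * k + (q * β + α) * τ) / m := by
    rw [le_div_iff₀ hm0]
    have := mul_le_mul_of_nonneg_left i3 hq0.le
    rw [hm]
    linarith
  have hmne : p * q - 1 ≠ 0 := hm0.ne'
  -- The three entries of Γ: `g1` compares the wave lower bound for B with `ib`, `g2` inserts `ib`
  -- in the data inequality `i2`, and `g3` inserts `ia` in the data inequality `i4`.
  have g1 : e ≤ (-l₂ / p + (q + 1) * k / m) - ((2 + p⁻¹) / m - ((n : ℝ) - 1) / 2) * τ := by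
    have e1 : e ≤ -l₂ / p - σ / p * τ + ((q + 1) * k + (q * β + α) * τ) / m := by
      have : e ≤ (-l₂ - σ * τ + p * b) / p := by rw [le_div_iff₀ hp0]; linarith
      refine this.trans ?_
      have e2 : (-l₂ - σ * τ + p * b) / p = -l₂ / p - σ / p * τ + b := by field_simp
      rw [e2]; linarith
    refine e1.trans (le_of_eq ?_)
    rw [hσ, hβ, hα, hm]
    field_simp
    ring
  have g2 : e ≤ (k - l₁ + (q + 1) * k / m) - ((q + 2) / m - n + 1) * τ := by
    have e1 : e ≤ k - l₁ + α * τ + ((q + 1) * k + (q * β + α) * τ) / m := by linarith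
    refine e1.trans (le_of_eq ?_)
    rw [hβ, hα, hm]
    field_simp
    ring
  have g3 : e ≤ (k - l₁ + (p + 1) * k / m) - ((2 * p + 1) / m - n) * τ := by
    have e1 : e ≤ k - l₁ + β * τ + ((p + 1) * k + (p * α + β) * τ) / m := by linarith
    have hmne' : q * p - 1 ≠ 0 := by rwa [mul_comm]
    refine e1.trans (le_of_eq ?_)
    rw [hβ, hα, hm]
    field_simp
    ring
  rw [Gam_zero, max_mul_of_nonneg _ _ hτ, max_mul_of_nonneg _ _ hτ, ← hm]
  refine max_le (max_le ?_ ?_) ?_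
  · have := (le_max_left (-l₂ / p + (q + 1) * k / m) (k - l₁ + (q + 1) * k / m)).trans
      (le_max_left _ (k - l₁ + (p + 1) * k / m))
    linarith
  · have := (le_max_right (-l₂ / p + (q + 1) * k / m) (k - l₁ + (q + 1) * k / m)).trans
      (le_max_left _ (k - l₁ + (p + 1) * k / m))
    linarith
  · have := le_max_right (max (-l₂ / p + (q + 1) * k / m) (k - l₁ + (q + 1) * k / m))
      (k - l₁ + (p + 1) * k / m)
    linarith

theorem log_mul_rpow_mul {K S x γ : ℝ} (hK : 0 < K) (hS : 0 < S) (hx : 0 < x) :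
    Real.log (K * S ^ γ * x) = Real.log K + γ * Real.log S + Real.log x := by
  rw [Real.log_mul (mul_pos hK (Real.rpow_pos_of_pos hS _)).ne' hx.ne',
    Real.log_mul hK.ne' (Real.rpow_pos_of_pos hS _).ne', Real.log_rpow hS]

/-- The algebra behind the lifespan estimate. -/
theorem lifespan_algebra {p q : ℝ} (hp : 1 < p) (hq : 1 < q) (hΓ : 0 < Gam n p q 0)
    {K c₁ c₂ : ℝ} (hK : 0 < K) (hc₁ : 0 < c₁) (hc₂ : 0 < c₂) :
    ∃ C : ℝ, 0 < C ∧ ∀ S ε A B : ℝ, 1 ≤ S → 0 < ε → 0 ≤ A →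
      A + c₁ * ε ≤ K * S ^ (-2 + ((n : ℝ) + 1) * (1 - 1 / p)) * B ^ (1 / p) →
      B + c₁ * ε ≤ K * S ^ (-1 + ((n : ℝ) + 1) * (1 - 1 / q)) * A ^ (1 / q) →
      c₂ * S ^ (1 + ((n : ℝ) - 1) * (1 - p / 2)) * ε ^ p ≤ B →
      S ≤ C * ε ^ (-(1 / Gam n p q 0)) := by
  obtain ⟨D, hD⟩ := exponent_algebra n hp hq (Real.log K) (Real.log c₁) (Real.log c₂)
  have hp0 : 0 < p := by linarith
  have hq0 : 0 < q := by linarith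
  refine ⟨Real.exp (D / Gam n p q 0), Real.exp_pos _, fun S ε A B hS1 hε hA h1 h2 h3 => ?_⟩
  have hS : 0 < S := by linarith
  have hεp : 0 < ε ^ p := Real.rpow_pos_of_pos hε p
  have hpre : 0 < c₂ * S ^ (1 + ((n : ℝ) - 1) * (1 - p / 2)) * ε ^ p :=
    mul_pos (mul_pos hc₂ (Real.rpow_pos_of_pos hS _)) hεp
  have hB' : 0 < B := lt_of_lt_of_le hpre h3
  have hce : 0 < c₁ * ε := mul_pos hc₁ hε
  -- Logarithms require A > 0; if A vanished, the second inequality would force B + c₁ε ≤ 0.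
  have hA' : 0 < A := by
    rcases hA.eq_or_lt with h | h
    · rw [← h, Real.zero_rpow (one_div_pos.2 hq0).ne', mul_zero] at h2
      linarith
    · exact h
  have r4 : Real.log (c₁ * ε) = Real.log c₁ + Real.log ε := Real.log_mul hc₁.ne' hε.ne'
  have qa : q * (1 / q * Real.log A) = Real.log A := by field_simp
  have pb : p * (1 / p * Real.log B) = Real.log B := by field_simp
  have hG := hD (Real.log S) (Real.log ε) (1 / q * Real.log A) (1 / p * Real.log B)
    (Real.log_nonneg hS1)
  rw [qa, pb, ← Real.log_rpow hB', ← Real.log_rpow hA', ← r4,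
    ← log_mul_rpow_mul hK hS (Real.rpow_pos_of_pos hB' _),
    ← log_mul_rpow_mul hK hS (Real.rpow_pos_of_pos hA' _)] at hG
  have hG' := hG (Real.log_le_log hA' (by linarith)) (Real.log_le_log hce (by linarith))
    (Real.log_le_log hB' (by linarith)) (Real.log_le_log hce (by linarith)) (by
      have := Real.log_le_log hpre h3
      rw [log_mul_rpow_mul hc₂ hS hεp, Real.log_rpow hε] at this
      linarith)
  have hτ' : Real.log S ≤ D / Gam n p q 0 + Real.log ε * (-(1 / Gam n p q 0)) := by
    have : D / Gam n p q 0 + Real.log ε * (-(1 / Gam n p q 0))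
        = (D - Real.log ε) / Gam n p q 0 := by field_simp; ring
    rw [this, le_div_iff₀ hΓ]
    linarith
  calc S = Real.exp (Real.log S) := (Real.exp_log hS).symm
    _ ≤ Real.exp (D / Gam n p q 0 + Real.log ε * (-(1 / Gam n p q 0))) := Real.exp_le_exp.2 hτ'
    _ = _ := by rw [Real.exp_add, Real.rpow_def_of_pos hε]

end Nakao

/-! ### Initial data and the lifespan bound -/

namespace Nakao

variable {n : ℕ}

section Datum

variable {R : ℝ} {f : Space n → ℝ}

theorem IsDatum.integral_pos (h : IsDatum R f) (hf : LocallyIntegrable f) : 0 < ∫ x, f x := by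
  have hi : Integrable f := by
    simpa using integrable_mul_of_suppInBall hf h.2.2 (g := fun _ => 1) continuous_const
  rw [integral_pos_iff_support_of_nonneg_ae h.1 hi, pos_iff_ne_zero]
  exact fun h0 => h.2.1 h0

theorem IsDatum.integral_exp_nonneg (h : IsDatum R f) (ξ : Space n) :
    0 ≤ ∫ x, f x * Real.exp (inner ℝ x ξ) := by
  refine integral_nonneg_of_ae ?_
  filter_upwards [h.1] with x hx
  exact mul_nonneg hx (Real.exp_pos _).le

/-- On the support of f one has |x·ξ| ≤ 2R, which makes the lower bound uniform over the frequency
shell. -/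
theorem IsDatum.le_integral_exp (h : IsDatum R f) (hf : LocallyIntegrable f) (hR : 0 ≤ R)
    {ξ : Space n} (hξ : ‖ξ‖ ≤ 2) :
    Real.exp (-(2 * R)) * ∫ x, f x ≤ ∫ x, f x * Real.exp (inner ℝ x ξ) := by
  rw [← integral_const_mul]
  have hi : Integrable f := by
    simpa using integrable_mul_of_suppInBall hf h.2.2 (g := fun _ => 1) continuous_const
  refine integral_mono_ae (hi.const_mul _)
    (integrable_mul_of_suppInBall hf h.2.2 (by fun_prop)) ?_
  filter_upwards [h.1, h.2.2] with x hx hx'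
  by_cases hxr : R < ‖x‖
  · simp [hx' hxr]
  · rw [mul_comm]
    refine mul_le_mul_of_nonneg_left (Real.exp_le_exp.2 ?_) hx
    have h1 := neg_le_of_abs_le (abs_real_inner_le_norm x ξ)
    have h2 : ‖x‖ * ‖ξ‖ ≤ R * 2 := by
      gcongr
      exact not_lt.1 hxr
    linarith

end Datum

/-- The moment equation for one component of the system. -/
theorem isMoment_component {T : EReal} {S R ε r : ℝ} {w w' z : ℝ → Space n → ℝ}
    {Dw : ℝ → Space n → Space n} {w₁ : Space n → ℝ} {β : ℝ → ℝ} (hS : 0 < S)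
    (hST : (S : EReal) < T) (hR : 0 < R) (hr : 0 < r)
    (hg : HasSpaceGradient T w Dw) (ht : HasTimeDeriv T w w')
    (hw : WeakIdentity T β w' Dw (fun x => ε * w₁ x) (fun s x => |z s x| ^ r))
    (hsupp : ∀ t ∈ Icc 0 S, SuppInBall (R + S) (w t)) (hw₁ : SuppInBall R w₁)
    (hz : MemLrloc T r z) (hzs : ∀ t ∈ Icc 0 S, SuppInBall (R + S) (z t))
    (hβ : IntervalIntegrable β volume 0 S) (ξ : Space n) :
    ∃ y, IsMoment S (‖ξ‖ ^ 2) (ε * ∫ x, w₁ x * Real.exp (inner ℝ x ξ)) β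
      (fun t => ∫ x, w t x * Real.exp (inner ℝ x ξ)) y
      (fun t => ∫ x, |z t x| ^ r * Real.exp (inner ℝ x ξ)) := by
  have hw₁' : SuppInBall (R + S) (fun x => ε * w₁ x) := by
    filter_upwards [hw₁.mono (by linarith : R ≤ R + S)] with x hx hx'
    rw [hx hx', mul_zero]
  obtain ⟨y, hy⟩ := isMoment_of_weakIdentity hS hST hR hg ht hw hsupp hw₁'
    (fun t ht => (hzs t (Ioc_subset_Icc_self ht)).abs_rpow hr) (hz.integrableOn hr hST _) hβ ξ
  refine ⟨y, ?_⟩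
  simpa only [mul_assoc, integral_const_mul] using hy

theorem isMoment_component_zero {S R ε r : ℝ} {T : EReal} {w w' z : ℝ → Space n → ℝ}
    {Dw : ℝ → Space n → Space n} {w₁ : Space n → ℝ} {β : ℝ → ℝ} (hS : 0 < S)
    (hST : (S : EReal) < T) (hR : 0 < R) (hr : 0 < r)
    (hg : HasSpaceGradient T w Dw) (ht : HasTimeDeriv T w w')
    (hw : WeakIdentity T β w' Dw (fun x => ε * w₁ x) (fun s x => |z s x| ^ r))
    (hsupp : ∀ t ∈ Icc 0 S, SuppInBall (R + S) (w t)) (hw₁ : SuppInBall R w₁)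
    (hz : MemLrloc T r z) (hzs : ∀ t ∈ Icc 0 S, SuppInBall (R + S) (z t))
    (hβ : IntervalIntegrable β volume 0 S) :
    ∃ y, IsMoment S 0 (ε * ∫ x, w₁ x) β (fun t => ∫ x, w t x) y (fun t => ∫ x, |z t x| ^ r) := by
  obtain ⟨y, hy⟩ := isMoment_component hS hST hR hr hg ht hw hsupp hw₁ hz hzs hβ 0
  refine ⟨y, ?_⟩
  simpa only [norm_zero, inner_zero_right, Real.exp_zero, mul_one, ne_eq, OfNat.ofNat_ne_zero,
    not_false_eq_true, zero_pow] using hy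

/-- On this window S/4 ≤ 1 + t ≤ S, the upper bound using S ≥ 4; this settles both signs of k. -/
theorem rpow_one_add_ge {S t : ℝ} (hS : 4 ≤ S) (ht : t ∈ Icc (S / 4) (S / 2)) (k : ℝ) :
    (4 : ℝ) ^ (-|k|) * S ^ k ≤ (1 + t) ^ k := by
  have hS0 : 0 < S := by linarith
  have h4 : (0 : ℝ) < 4 ^ |k| := by positivity
  rw [Real.rpow_neg (by norm_num), inv_mul_eq_div]
  rcases le_total 0 k with hk | hk
  · rw [abs_of_nonneg hk, ← Real.div_rpow hS0.le (by norm_num)]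
    exact Real.rpow_le_rpow (by positivity) (by linarith [ht.1]) hk
  · have h1 : S ^ k ≤ (1 + t) ^ k :=
      Real.rpow_le_rpow_of_nonpos (by linarith [ht.1]) (by linarith [ht.2]) hk
    refine (div_le_self (by positivity) ?_).trans h1
    exact Real.one_le_rpow (by norm_num) (abs_nonneg k)

/-- Only the window [S/4, S/2] is kept: its length is S/4, the weight there is at least 2^(-i), and
S ≥ 4 ensures t ≥ 1, where the lower bound on N is available. -/
theorem integral_weight_ge {N : ℝ → ℝ} {S c k : ℝ} (hS : 4 ≤ S) (hc : 0 ≤ c)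
    (hNi : IntervalIntegrable N volume 0 S) (hN : ∀ t, 0 ≤ N t)
    (hle : ∀ᵐ t, t ∈ Ioc 0 S → 1 ≤ t → c * (1 + t) ^ k ≤ N t) (i : ℕ) :
    (1 / 4) * (1 / 2) ^ i * (4 : ℝ) ^ (-|k|) * c * S ^ (1 + k) ≤
      ∫ t in (0 : ℝ)..S, (1 - t / S) ^ i * N t := by
  have hS0 : 0 < S := by linarith
  have hi : IntervalIntegrable (fun t => (1 - t / S) ^ i * N t) volume 0 S :=
    hNi.continuousOn_mul (by fun_prop)
  have h1 : ∫ t in (S / 4)..(S / 2), (1 - t / S) ^ i * N t ≤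
      ∫ t in (0 : ℝ)..S, (1 - t / S) ^ i * N t := by
    refine intervalIntegral.integral_mono_interval (by positivity) (by linarith) (by linarith) ?_ hi
    filter_upwards [ae_restrict_mem measurableSet_Ioc] with t ht
    have : t / S ≤ 1 := (div_le_one hS0).2 ht.2
    exact mul_nonneg (pow_nonneg (by linarith) _) (hN t)
  refine le_trans ?_ h1
  have h2 : ∫ t in (S / 4)..(S / 2), (1 / 2 : ℝ) ^ i * (c * ((4 : ℝ) ^ (-|k|) * S ^ k)) ≤
      ∫ t in (S / 4)..(S / 2), (1 - t / S) ^ i * N t := by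
    refine intervalIntegral.integral_mono_ae_restrict (by linarith) (by simp)
      (hi.mono_set ?_) ?_
    · rw [uIcc_of_le (by linarith), uIcc_of_le hS0.le]
      exact Icc_subset_Icc (by positivity) (by linarith)
    · rw [EventuallyLE, ae_restrict_iff' measurableSet_Icc]
      filter_upwards [hle] with t ht hts
      have k1 := ht ⟨by linarith [hts.1], by linarith [hts.2]⟩ (by linarith [hts.1])
      have k2 : t / S ≤ 1 / 2 := by rw [div_le_iff₀ hS0]; linarith [hts.2]
      have k3 := rpow_one_add_ge hS hts k
      refine mul_le_mul (pow_le_pow_left₀ (by norm_num) (by linarith) i)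
        (le_trans (mul_le_mul_of_nonneg_left k3 hc) k1) (by positivity)
        (pow_nonneg (by linarith) _)
  refine le_trans (le_of_eq ?_) h2
  rw [intervalIntegral.integral_const, smul_eq_mul, Real.rpow_add hS0, Real.rpow_one]
  ring

theorem lifespan_bound (hn : 1 ≤ n) {p q : ℝ} (hp : 1 < p) (hq : 1 < q)
    {b : ℝ → ℝ} (hb : IntegrableOn b (Ici 0))
    (hb0 : ∀ᵐ t ∂(volume.restrict (Ici (0 : ℝ))), 0 ≤ b t)
    {R : ℝ} (hR : 0 < R) {u₀ u₁ v₀ v₁ : Space n → ℝ}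
    (hu₁ : LocallyIntegrable u₁) (hv₁ : LocallyIntegrable v₁)
    (du₀ : IsDatum R u₀) (du₁ : IsDatum R u₁) (dv₀ : IsDatum R v₀) (dv₁ : IsDatum R v₁)
    (hΓ : 0 < Gam n p q 0) :
    ∃ C : ℝ, 0 < C ∧ ∀ (ε S : ℝ) (T : EReal) (u v : ℝ → Space n → ℝ), 0 < ε → 4 ≤ S →
      (S : EReal) < T → IsWeakSolution p q b R ε u₀ u₁ v₀ v₁ T u v →
      S ≤ C * ε ^ (-(1 / Gam n p q 0)) := by
  have hp0 : 0 < p := by linarith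
  have hq0 : 0 < q := by linarith
  set m := Real.exp (-∫ t in Ici (0 : ℝ), b t) with hm
  have hm0 : 0 < m := Real.exp_pos _
  have hu₁p := du₁.integral_pos hu₁
  have hv₁p := dv₁.integral_pos hv₁
  set Ju := ∫ x, u₁ x
  set Jv := ∫ x, v₁ x
  -- One power j serves both Hölder steps: j(r-1) ≥ 2 for r = p and for r = q.
  obtain ⟨j, hj⟩ := exists_nat_ge (max (2 / (p - 1)) (2 / (q - 1)))
  have hjp : (j + 2 : ℝ) ≤ j * p := by
    have := (le_max_left _ _).trans hj
    rw [div_le_iff₀ (by linarith)] at this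
    linarith
  have hjq : (j + 2 : ℝ) ≤ j * q := by
    have := (le_max_right _ _).trans hj
    rw [div_le_iff₀ (by linarith)] at this
    linarith
  obtain ⟨c, hc, hclow⟩ := integral_rpow_ge_of_moments hn hR.le hp
  set V := (volume : Measure (Space n)).real (Metric.ball 0 1) * (R + 1) ^ n with hV
  have hV0 : 0 ≤ V := by positivity
  set Kp := V ^ (1 - 1 / p) with hKp
  set Kq := V ^ (1 - 1 / q) with hKq
  have hKp0 : 0 ≤ Kp := Real.rpow_nonneg hV0 _
  have hKq0 : 0 ≤ Kq := Real.rpow_nonneg hV0 _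
  set k := ((n : ℝ) - 1) * (1 - p / 2) with hk
  -- A single K dominates the constants of both loop inequalities; the summand 1 makes it positive
  -- at once. The constant c₂ collects the window loss of `integral_weight_ge` and the growth
  -- amplitude m/8 · e^(-2R) ∫v₁, raised to the power p.
  obtain ⟨C, hC, hCle⟩ := lifespan_algebra hp hq hΓ
    (K := ((j : ℝ) + 2) ^ 2 * Kp / m + 2 * ((j : ℝ) + 2) ^ 2 * Kq + 1) (c₁ := min Ju Jv)
    (c₂ := (1 / 4) * (1 / 2) ^ (j + 2) * (4 : ℝ) ^ (-|k|) *
      (c * (m / 8 * (Real.exp (-(2 * R)) * Jv)) ^ p))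
    (by positivity) (lt_min hu₁p hv₁p) (by positivity)
  refine ⟨C, hC, fun ε S T u v hε hS4 hST hsol => ?_⟩
  obtain ⟨-, u', v', Du, Dv, hgu, htu, hLu, hgv, htv, hLv, hsupp, hu0, hv0, hwu, hwv⟩ := hsol
  have hS : 0 < S := by linarith
  have hS1 : 1 ≤ S := by linarith
  have hmem := Icc_subset_times hST
  have hstep : ∀ w w₀ : Space n → ℝ, IsDatum R w₀ → w =ᵐ[volume] (fun x => ε * w₀ x) →
      SuppInBall R w := fun w w₀ h h' => by
    filter_upwards [h.2.2, h'] with x hx hx' hxr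
    rw [hx', hx hxr, mul_zero]
  have hsu : ∀ t ∈ Icc 0 S, SuppInBall (R + S) (u t) := fun t ht => by
    rcases ht.1.eq_or_lt with h | h
    · rw [← h]; exact (hstep _ _ du₀ hu0).mono (by linarith)
    · exact (hsupp t h (hmem ht).2).1.mono (by linarith [ht.2])
  have hsv : ∀ t ∈ Icc 0 S, SuppInBall (R + S) (v t) := fun t ht => by
    rcases ht.1.eq_or_lt with h | h
    · rw [← h]; exact (hstep _ _ dv₀ hv0).mono (by linarith)
    · exact (hsupp t h (hmem ht).2).2.mono (by linarith [ht.2])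
  have hbi : IntervalIntegrable b volume 0 S := by
    rw [intervalIntegrable_iff_integrableOn_Ioc_of_le hS.le]
    exact hb.mono_set fun t ht => ht.1.le
  have hb0' : ∀ᵐ s : ℝ, s ∈ Icc 0 S → 0 ≤ b s := by
    rw [ae_restrict_iff' measurableSet_Ici] at hb0
    filter_upwards [hb0] with s hs hs' using hs hs'.1
  have hmle : ∀ t ∈ Icc 0 S, m ≤ Real.exp (-∫ s in (0 : ℝ)..t, b s) := fun t ht => by
    rw [hm]
    refine Real.exp_le_exp.2 (neg_le_neg ?_)
    rw [intervalIntegral.integral_of_le ht.1]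
    exact setIntegral_mono_set hb hb0 (Eventually.of_forall fun s hs => hs.1.le)
  have hNu : ∀ t, 0 ≤ ∫ x, |u t x| ^ q := fun t =>
    integral_nonneg fun x => Real.rpow_nonneg (abs_nonneg _) _
  have hNv : ∀ t, 0 ≤ ∫ x, |v t x| ^ p := fun t =>
    integral_nonneg fun x => Real.rpow_nonneg (abs_nonneg _) _
  have hinit : ∀ (w w₀ : Space n → ℝ) (ξ : Space n), IsDatum R w₀ →
      w =ᵐ[volume] (fun x => ε * w₀ x) → 0 ≤ ∫ x, w x * Real.exp (inner ℝ x ξ) :=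
    fun w w₀ ξ h h' => by
      have : ∫ x, w x * Real.exp (inner ℝ x ξ) = ε * ∫ x, w₀ x * Real.exp (inner ℝ x ξ) := by
        rw [← integral_const_mul]
        refine integral_congr_ae ?_
        filter_upwards [h'] with x hx
        rw [hx, mul_assoc]
      rw [this]
      exact mul_nonneg hε.le (h.integral_exp_nonneg ξ)
  have hinit0 : ∀ (w w₀ : Space n → ℝ), IsDatum R w₀ →
      w =ᵐ[volume] (fun x => ε * w₀ x) → 0 ≤ ∫ x, w x := fun w w₀ h h' => by
    simpa using hinit w w₀ 0 h h'
  obtain ⟨yu, hMu⟩ := isMoment_component_zero hS hST hR hp0 hgu htu hwu hsu du₁.2.2 hLv hsv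
    (by simp)
  obtain ⟨yv, hMv⟩ := isMoment_component_zero hS hST hR hq0 hgv htv hwv hsv dv₁.2.2 hLu hsu hbi
  have aeu := ae_integrable_abs_rpow hq0 (hLu.integrableOn hq0 hST (R + S)) hsu
  have aev := ae_integrable_abs_rpow hp0 (hLv.integrableOn hp0 hST (R + S)) hsv
  have hHu := integral_abs_mean_le hq hR.le hS1 (fun t ht => (hgu.1 t (hmem ht)).1) aeu hsu
    hMu.contH hMv.intN hjq
  have hHv := integral_abs_mean_le hp hR.le hS1 (fun t ht => (hgv.1 t (hmem ht)).1) aev hsv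
    hMv.contH hMu.intN hjp
  have hEu := hMu.heat_estimate hS1 (hinit0 _ _ du₀ hu0) j
  have hEv := hMv.wave_estimate hS hb0' hNu (hinit0 _ _ dv₀ hv0) (mul_pos hε hv₁p) hmle j
  set A := ∫ t in (0 : ℝ)..S, (1 - t / S) ^ (j + 2) * ∫ x, |u t x| ^ q with hA
  set B := ∫ t in (0 : ℝ)..S, (1 - t / S) ^ (j + 2) * ∫ x, |v t x| ^ p with hB
  have hw0 : ∀ t ∈ Icc 0 S, 0 ≤ (1 - t / S) ^ (j + 2) := fun t ht => by
    have : t / S ≤ 1 := (div_le_one hS).2 ht.2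
    exact pow_nonneg (by linarith) _
  have hA0 : 0 ≤ A := intervalIntegral.integral_nonneg hS.le fun t ht =>
    mul_nonneg (hw0 t ht) (hNu t)
  have hB0 : 0 ≤ B := intervalIntegral.integral_nonneg hS.le fun t ht =>
    mul_nonneg (hw0 t ht) (hNv t)
  refine hCle S ε A B hS1 hε hA0 ?_ ?_ ?_
  · have e1 : A + ε * Jv ≤ (((j : ℝ) + 2) ^ 2 * Kp / m) *
        S ^ (-2 + ((n : ℝ) + 1) * (1 - 1 / p)) * B ^ (1 / p) := by
      have e2 : m * (A + ε * Jv) ≤ (j + 2) ^ 2 / S ^ 2 *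
          (Kp * S ^ (((n : ℝ) + 1) * (1 - 1 / p)) * B ^ (1 / p)) := by
        refine hEv.trans ?_
        gcongr
      rw [← le_div_iff₀' hm0] at e2
      refine e2.trans (le_of_eq ?_)
      rw [Real.rpow_add hS, Real.rpow_neg hS.le, Real.rpow_two]
      field_simp
    have e3 : min Ju Jv * ε ≤ ε * Jv := by
      rw [mul_comm]; gcongr; exact min_le_right _ _
    have e4 : (((j : ℝ) + 2) ^ 2 * Kp / m) ≤
        ((j : ℝ) + 2) ^ 2 * Kp / m + 2 * ((j : ℝ) + 2) ^ 2 * Kq + 1 := by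
      have : 0 ≤ 2 * ((j : ℝ) + 2) ^ 2 * Kq := by positivity
      linarith
    refine (add_le_add le_rfl e3).trans (e1.trans ?_)
    gcongr
  · have e1 : B + ε * Ju ≤ (2 * ((j : ℝ) + 2) ^ 2 * Kq) *
        S ^ (-1 + ((n : ℝ) + 1) * (1 - 1 / q)) * A ^ (1 / q) := by
      have e2 : B + ε * Ju ≤ 2 * (j + 2) ^ 2 / S *
          (Kq * S ^ (((n : ℝ) + 1) * (1 - 1 / q)) * A ^ (1 / q)) := by
        refine hEu.trans ?_
        gcongr
      refine e2.trans (le_of_eq ?_)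
      rw [Real.rpow_add hS, Real.rpow_neg hS.le, Real.rpow_one]
      field_simp
    have e3 : min Ju Jv * ε ≤ ε * Ju := by
      rw [mul_comm]; gcongr; exact min_le_left _ _
    have e4 : 2 * ((j : ℝ) + 2) ^ 2 * Kq ≤
        ((j : ℝ) + 2) ^ 2 * Kp / m + 2 * ((j : ℝ) + 2) ^ 2 * Kq + 1 := by
      have : 0 ≤ ((j : ℝ) + 2) ^ 2 * Kp / m := by positivity
      linarith
    refine (add_le_add le_rfl e3).trans (e1.trans ?_)
    gcongr
  · set δ := m / 8 * (Real.exp (-(2 * R)) * Jv) with hδ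
    have hδ0 : 0 ≤ δ := by positivity
    -- Each ξ in the shell has its own moment equation for v; the growth amplitude δε does not
    -- depend on ξ, as the averaging over frequencies requires.
    have hlow : ∀ᵐ t, t ∈ Ioc 0 S → 1 ≤ t → c * (δ * ε) ^ p * (1 + t) ^ k ≤ ∫ x, |v t x| ^ p := by
      filter_upwards [aev] with t ht hts ht1
      have hts' := Ioc_subset_Icc_self hts
      refine hclow t (v t) (δ * ε) hts.1.le (by positivity) (hgv.1 t (hmem hts')).1
        (hsupp t hts.1 (hmem hts').2).2 (ht hts) fun ξ hξ => ?_
      obtain ⟨y, hy⟩ := isMoment_component hS hST hR hq0 hgv htv hwv hsv dv₁.2.2 hLu hsu hbi ξ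
      have h1 := dv₁.le_integral_exp hv₁ hR.le hξ.2
      have h2 : 0 < Real.exp (-(2 * R)) * Jv := by positivity
      refine le_trans ?_ (hy.growth hξ.1 hξ.2 hb0'
        (fun s => integral_nonneg fun x => by positivity) (hinit _ _ ξ dv₀ hv0)
        (mul_pos hε (h2.trans_le h1)) hm0.le hmle ⟨ht1, hts.2⟩)
      have h3 : δ * ε = m / 8 * (ε * (Real.exp (-(2 * R)) * Jv)) := by rw [hδ]; ring
      rw [h3]
      gcongr
    have h4 := integral_weight_ge hS4 (by positivity) hMu.intN hNv hlow (j + 2)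
    refine le_trans (le_of_eq ?_) h4
    rw [Real.mul_rpow hδ0 hε.le]
    ring

end Nakao

theorem theorem2 (n : ℕ) (hn : 1 ≤ n) (p q : ℝ) (hp : 1 < p) (hq : 1 < q)
    (b : ℝ → ℝ) (hb : IntegrableOn b (Ici 0))
    (hb0 : ∀ᵐ t ∂(volume.restrict (Ici (0 : ℝ))), 0 ≤ b t)
    (R : ℝ) (hR : 0 < R) (u₀ u₁ v₀ v₁ : Nakao.Space n → ℝ)
    (hu₀ : Nakao.MemW11loc u₀) (hu₁ : LocallyIntegrable u₁)
    (hv₀ : Nakao.MemW11loc v₀) (hv₁ : LocallyIntegrable v₁)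
    (du₀ : Nakao.IsDatum R u₀) (du₁ : Nakao.IsDatum R u₁)
    (dv₀ : Nakao.IsDatum R v₀) (dv₁ : Nakao.IsDatum R v₁)
    (hΓ : 0 < Nakao.Gam n p q 0) :
    ∃ ε₀ : ℝ, 0 < ε₀ ∧ ∃ C : ℝ, 0 < C ∧
      ∀ ε : ℝ, 0 < ε → ε ≤ ε₀ →
        ∀ (T : EReal) (u v : ℝ → Nakao.Space n → ℝ),
          Nakao.IsWeakSolution p q b R ε u₀ u₁ v₀ v₁ T u v →
            T < ⊤ ∧ T ≤ ((C * ε ^ (-(1 / Nakao.Gam n p q 0)) : ℝ) : EReal) := by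
  obtain ⟨C, hC, hbound⟩ := Nakao.lifespan_bound hn hp hq hb hb0 hR hu₁ hv₁ du₀ du₁ dv₀ dv₁ hΓ
  -- For ε ≤ 1 the power of ε is at least 1, so any S beyond the claimed bound with constant C + 4
  -- automatically satisfies S ≥ 4. Choosing such a real S below T treats finite and infinite T
  -- together.
  refine ⟨1, one_pos, C + 4, by positivity, fun ε hε hε1 T u v hsol => ?_⟩
  have hpow : 1 ≤ ε ^ (-(1 / Nakao.Gam n p q 0)) :=
    Real.one_le_rpow_of_pos_of_le_one_of_nonpos hε hε1 (neg_nonpos.2 (one_div_pos.2 hΓ).le)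
  have hT : T ≤ (((C + 4) * ε ^ (-(1 / Nakao.Gam n p q 0)) : ℝ) : EReal) := by
    by_contra hcon
    push Not at hcon
    obtain ⟨S, hS, hST⟩ := EReal.lt_iff_exists_real_btwn.1 hcon
    rw [EReal.coe_lt_coe_iff] at hS
    have h4 : 4 ≤ S := by nlinarith
    have := hbound ε S T u v hε h4 hST hsol
    nlinarith
  exact ⟨hT.trans_lt (EReal.coe_lt_top _), hT⟩
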